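/- Model. Fix an integer $c\ge 1$. An $n$-node instance $(G,x,\mathrm{id})$ consists of a connected simple graph $G=(V,E)$ with $|V|=n\ge 1$, pairwise distinct identities $\mathrm{id}(v)\in[1,n^c]$ of the nodes, and a label $x(v)$ for every node $v$, here a finite set of natural numbers (read as identities). A proof-labeling scheme (PLS) of radius $t\ge1$ for a predicate $\mathcal P$ on instances is a pair $(\mathbf p,\mathbf v)$. The prover $\mathbf p$ assigns a bit string (certificate) to every node of every instance. The verifier $\mathbf v$ outputs accept or reject at every node $v$, as a function of the identity of $v$ and of the subgraph of $G$ induced by the nodes at distance at most $t$ from $v$, together with the identities, labels and certificates of these nodes. If the instance satisfies $\mathcal P$, all nodes accept the certificates given by $\mathbf p$; if it does not satisfy $\mathcal P$, then for every assignment of certificates at least one node rejects. The size of $(\mathbf p,\mathbf v)$ is the largest number of bits that $\mathbf p$ assigns to a node, over all $n$-node instances satisfying $\mathcal P$, and $\mathsf{size}\text{-}\mathsf{pls}(\mathcal P,t)$ is the minimum size of a PLS of radius at most $t$ for $\mathcal P$ on $n$-node instances, as a function of $n$. For integers $\alpha\ge 1$, $\beta\ge 0$, an instance satisfies $(\alpha,\beta)$-spanner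 if, for every node $v$, $x(v)\subseteq\{\mathrm{id}(w) : w\in N(v)\}$, and the graph $H$ on $V$ with edge set $\{\{v,w\} : \mathrm{id}(w)\in x(v)\}$ satisfies $\mathrm{dist}_H(u,v)\le\alpha\,\mathrm{dist}_G(u,v)+\beta$ for all nodes $u,v$ (distances are infinite between different components). The predicate $\beta$-additive spanner is $(1,\beta)$-spanner. Theorem. The constants hidden in parts 1 and 2 depend only on $c$, and those in parts 3 and 4 only on $c$ and $\beta$; $\widetilde O$ and $\widetilde\Theta$ hide factors polylogarithmic in $n$. 1. For all integers $\alpha\ge1$, $\beta\ge0$ there is a PLS of radius $1$ for $(\alpha,\beta)$-spanner of size $O(n)$. 2. For all integers $\alpha\ge1$, $\beta\ge0$ and $t\ge 1$ there is a PLS of radius $t$ for $(\alpha,\beta)$-spanner of size $\widetilde O(n/t)$, for all $n\ge 2$. 3. For every integer $\beta\ge0$, $\beta$-additive spanner has a family of PLSs, one of radius $t$ for each $t\ge1$, that weakly scales linearly on $[1,n/\log n]$: for all sufficiently large $n$ and all integers $t\in[1,n/\log n]$, the radius-$t$ scheme has size $\widetilde O\big(\tfrac1t\,\mathsf{size}\text{-}\mathsf{pls}(\beta\text{-additive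 spanner},1)\big)$. 4. For every integer $\beta\ge 1$, for all sufficiently large $n$ and all integers $t\in[1,n/\log n]$, $$\mathsf{size}\text{-}\mathsf{pls}(\beta\text{-additive spanner},t)=\widetilde\Theta\left(\frac nt\right).$$ In parts 1, 2 and 3 the verifier of the scheme for a given $t$ is the same for all $n$. -/

import Mathlib

open scoped ENNReal

/-- An instance `(G, x, id)` on `n` nodes: a connected simple graph `G`, a label `x v` in `L` for
every node `v`, and distinct identities `id v` in `[1, n ^ c]`. -/
structure LabeledNetwork (L : Type) (c n : ℕ) where
  graph : SimpleGraph (Fin n)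
  connected : graph.Connected
  label : Fin n → L
  id : Fin n → ℕ
  id_injective : Function.Injective id
  one_le_id : ∀ v, 1 ≤ id v
  id_le : ∀ v, id v ≤ n ^ c

/-- What a node may learn in a bounded number of rounds of the LOCAL model. Nodes are known through
their identities only. -/
structure LocalView (L : Type) where
  /-- the identity of the node itself -/
  center : ℕ
  /-- the triples (identity, label, certificate) of all visible nodes -/
  nodes : Set (ℕ × L × List Bool)
  /-- the pairs of identities of adjacent visible nodes -/
  edges : Set (ℕ × ℕ)

namespace LabeledNetwork

variable {L : Type} {c n : ℕ}

/-- The ball of radius `t` around `v`. -/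
def ball (I : LabeledNetwork L c n) (t : ℕ) (v : Fin n) : Set (Fin n) :=
  {w | I.graph.dist v w ≤ t}

/-- The radius-`t` view of the node `v` when the certificates `cert` are given to the nodes: the
subgraph induced by the ball of radius `t` around `v`, with the identities, the labels and the
certificates of its nodes. -/
def view (I : LabeledNetwork L c n) (t : ℕ) (cert : Fin n → List Bool) (v : Fin n) :
    LocalView L where
  center := I.id v
  nodes := {a | ∃ w ∈ I.ball t v, a = (I.id w, I.label w, cert w)}
  edges := {e | ∃ u ∈ I.ball t v, ∃ w ∈ I.ball t v, I.graph.Adj u w ∧ e = (I.id u, I.id w)}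

end LabeledNetwork

/-- A prover on `n`-node instances: an oracle that gives a bit string to every node of every
instance. -/
abbrev Prover (L : Type) (c n : ℕ) := LabeledNetwork L c n → Fin n → List Bool

/-- A verifier: the verdict of a node, as a function of its view. -/
abbrev Verifier (L : Type) := LocalView L → Prop

/-- The radius-`t` verifier `V` accepts: every node accepts. -/
def Accepts {L : Type} {c n : ℕ} (V : Verifier L) (t : ℕ) (I : LabeledNetwork L c n)
    (cert : Fin n → List Bool) : Prop :=
  ∀ v, V (I.view t cert v)

/-- `(p, V)` is a proof-labeling scheme of radius (at most) `t` for the predicate `P` on `n`-node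
instances. -/
structure IsPLS {L : Type} {c n : ℕ} (t : ℕ) (P : LabeledNetwork L c n → Prop)
    (p : Prover L c n) (V : Verifier L) : Prop where
  complete : ∀ I, P I → Accepts V t I (p I)
  sound : ∀ I, ¬ P I → ∀ cert : Fin n → List Bool, ¬ Accepts V t I cert

/-- The certificate size of the prover `p` for `P`: the largest number of bits that `p` gives to a
node, over all instances that satisfy `P`. -/
noncomputable def certSize {L : Type} {c n : ℕ} (P : LabeledNetwork L c n → Prop)
    (p : Prover L c n) : ℕ∞ :=
  ⨆ (I : LabeledNetwork L c n) (_ : P I) (v : Fin n), ((p I v).length : ℕ∞)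

/-- The minimum certificate size of a proof-labeling scheme of radius at most `t` for `P` on
`n`-node instances. -/
noncomputable def sizePLS {L : Type} {c n : ℕ} (t : ℕ) (P : LabeledNetwork L c n → Prop) : ℕ∞ :=
  ⨅ (p : Prover L c n) (V : Verifier L) (_ : IsPLS t P p V), certSize P p

/-- The graph `H` described by labels that are sets of identities: `{v, w}` is an edge if the
identity of `w` is in the label of `v`, or the other way round. -/
def markedGraph {c n : ℕ} (I : LabeledNetwork (Finset ℕ) c n) : SimpleGraph (Fin n) :=
  SimpleGraph.fromRel (fun v w => I.id w ∈ I.label v)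

/-- The predicate `(α, β)`-spanner: every label is a set of identities of neighbours, and the graph
`H` of the marked edges satisfies `dist_H(u, v) ≤ α * dist_G(u, v) + β` for all nodes `u, v`.
Distances are extended (`⊤` between different components of `H`). -/
def IsSpanner (α β : ℕ) {c n : ℕ} (I : LabeledNetwork (Finset ℕ) c n) : Prop :=
  (∀ v, ∀ i ∈ I.label v, ∃ w, I.graph.Adj v w ∧ I.id w = i) ∧
  ∀ u v, (markedGraph I).edist u v ≤ (α : ℕ∞) * I.graph.edist u v + (β : ℕ∞)

/-- The predicate `β`-additive spanner: `dist_H(u, v) ≤ dist_G(u, v) + β`. -/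
def IsAdditiveSpanner (β : ℕ) {c n : ℕ} (I : LabeledNetwork (Finset ℕ) c n) : Prop :=
  (∀ v, ∀ i ∈ I.label v, ∃ w, I.graph.Adj v w ∧ I.id w = i) ∧
  ∀ u v, (markedGraph I).edist u v ≤ I.graph.edist u v + (β : ℕ∞)

/-!
Everything rests on potentials. Let `G` be the network and `H` the graph of the marked edges. If
every node `v` holds, for every node `s`, numbers `f` and `g` such that `g` vanishes at `s` and
changes by at most `1` along the edges of `G`, and `f`, where it is not `0`, decreases along some
edge of `H` and vanishes at `s` only, then `dist_H ≤ f` and `g ≤ dist_G`. So the local inequalities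
`f ≤ α g + β` prove that `H` is an `(α, β)`-spanner (`NodeCheck.isSpanner`), and the true distances
satisfy them if it is one (`IsSpanner.nodeCheck`). The question is how to store the potentials in
few bits. The vertices of a connected graph can be ordered such that consecutive distances add up to
at most `2 n` (`SimpleGraph.Connected.exists_short_tour`); this is used twice.

* One round. The nodes `s` are known by their ranks in such an ordering of `H`. The distances from
  a fixed node to the nodes of rank `0, 1, 2, …` vary by at most `2 n` in total, so that their
  differences take `O(n)` bits. That the ranks are distinct is a matter of counting: the potentials
  show that every rank occurs, and a tree with subtree sizes (`card_le_sum_roots`) shows that there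
  are no more nodes than ranks.

* `t` rounds. The nodes `s` are known by their identities. A node stores its distance to `s` only if
  it is congruent modulo `t` to twice the position of `s` on the tour. As a shortest path to `s` runs
  through all residues within `t` nodes, all potentials can be recovered from the nodes at distance
  less than `t` (`estimate_eq_edist`); and as twice the position minus the distance is strictly
  increasing along the tour, a node stores `O(n / t)` distances only (`card_residue_le`).

* The lower bound is a fooling set argument. In the hard instances the marked edges are fixed: for
  all bit vectors `i` and `j` of length `b` there are vertices `left i` and `right j`, which are
  joined by a path of length `L + 2` through one of `2 b` shared bit paths if `i` and `j` differ
  somewhere, and by a slightly longer shared hub path in any case. Unmarked edges lead from `left i`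
  with `A i` and from `right j` with `B j` to the hub path; each of them saves `β`. One saving is
  allowed, but two are not, unless `i` and `j` differ and a bit path is short anyway. So there is a
  spanner if and only if `A` and `B` are disjoint. The `2 b + 1` paths are longer than `2 t`; if two
  instances in which `B` is the complement of `A` have the same certificates there, then their
  halves can be joined to an instance that is accepted though `A` and `B` meet (`succ_le_sizePLS`).
  With `2 ^ b` of order `n`, this needs certificates of order `n / (t log n)`. If `t` is so large
  that this is less than one bit, then the instances with `b = 0` show that one bit is needed.
-/

/-! ### Self-delimiting encoding of lists of natural numbers -/

/-- A prefix code for bit strings: every bit is preceded by `true`, and `false` ends the string. -/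
def selfDelimit : List Bool → List Bool
  | [] => [false]
  | b :: l => true :: b :: selfDelimit l

theorem length_selfDelimit (l : List Bool) : (selfDelimit l).length = 2 * l.length + 1 := by
  induction l with
  | nil => rfl
  | cons b l ih => simp only [selfDelimit, List.length_cons, ih]; ring

theorem selfDelimit_append_inj : ∀ {l l' r r' : List Bool},
    selfDelimit l ++ r = selfDelimit l' ++ r' → l = l' ∧ r = r'
  | [], [], _, _, h => by simpa [selfDelimit] using h
  | [], _ :: _, _, _, h => by simp [selfDelimit] at h
  | _ :: _, [], _, _, h => by simp [selfDelimit] at h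
  | a :: l, b :: l', r, r', h => by
    simp only [selfDelimit, List.cons_append, List.cons.injEq, true_and] at h
    obtain ⟨h1, h2⟩ := selfDelimit_append_inj h.2
    exact ⟨by rw [h.1, h1], h2⟩

theorem Nat.bits_injective : Function.Injective Nat.bits := by
  intro a
  induction a using Nat.binaryRec' with
  | zero =>
    intro b h
    have := congrArg List.length h
    rw [Nat.size_eq_bits_len, Nat.size_eq_bits_len, Nat.size_zero] at this
    exact (Nat.size_eq_zero.1 this.symm).symm
  | bit x a hx ih =>
    intro b h
    induction b using Nat.binaryRec' with
    | zero =>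
      have := congrArg List.length h
      rw [Nat.size_eq_bits_len, Nat.size_eq_bits_len, Nat.size_zero] at this
      exact Nat.size_eq_zero.1 this
    | bit y b hy _ =>
      rw [Nat.bits_append_bit a x hx, Nat.bits_append_bit b y hy, List.cons.injEq] at h
      rw [h.1, ih h.2]

/-- The bit string that encodes a list of natural numbers. -/
def encodeList (l : List ℕ) : List Bool :=
  l.flatMap fun x => selfDelimit x.bits

theorem encodeList_injective : Function.Injective encodeList := by
  intro l
  induction l with
  | nil =>
    rintro (_ | ⟨b, l'⟩) h
    · rfl
    · have := congrArg List.length h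
      simp only [encodeList, List.flatMap_nil, List.flatMap_cons, List.length_nil,
        List.length_append, length_selfDelimit] at this
      omega
  | cons a l ih =>
    rintro (_ | ⟨b, l'⟩) h
    · have := congrArg List.length h
      simp only [encodeList, List.flatMap_nil, List.flatMap_cons, List.length_nil,
        List.length_append, length_selfDelimit] at this
      omega
    · obtain ⟨h1, h2⟩ := selfDelimit_append_inj (l := a.bits) (l' := b.bits)
        (r := encodeList l) (r' := encodeList l') (by simpa [encodeList] using h)
      rw [Nat.bits_injective h1, ih h2]

theorem length_encodeList (l : List ℕ) :
    (encodeList l).length = (l.map fun x => 2 * x.size + 1).sum := by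
  simp only [encodeList, List.length_flatMap, length_selfDelimit, Nat.size_eq_bits_len]

/-- The inverse of `encodeList`. -/
noncomputable def decodeList : List Bool → List ℕ :=
  Function.invFun encodeList

@[simp] theorem decodeList_encodeList (l : List ℕ) : decodeList (encodeList l) = l :=
  Function.leftInverse_invFun encodeList_injective l

theorem Nat.size_le_self (x : ℕ) : x.size ≤ x :=
  Nat.size_le.2 Nat.lt_two_pow_self

theorem Nat.size_pow_le (x c : ℕ) : (x ^ c).size ≤ c * x.size + 1 := by
  rw [Nat.size_le, pow_succ, mul_comm c, pow_mul]
  have := Nat.pow_le_pow_left (Nat.lt_size_self x).le c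
  have h2 : 0 < (2 ^ x.size) ^ c := by positivity
  omega

/-! ### Short orderings of the vertices of a connected graph -/

/-- The length of the tour that visits the points of a list in order. -/
def tourLength {V : Type*} (d : V → V → ℕ) : List V → ℕ
  | [] => 0
  | [_] => 0
  | a :: b :: l => d a b + tourLength d (b :: l)

theorem tourLength_insert_le {V : Type*} (d : V → V → ℕ) {u v : V} {K : ℕ}
    (h0 : d u v ≤ K) (h : ∀ x, d u v + d v x ≤ d u x + K) (l₁ l₂ : List V) :
    tourLength d (l₁ ++ u :: v :: l₂) ≤ tourLength d (l₁ ++ u :: l₂) + K := by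
  induction l₁ with
  | nil =>
    cases l₂ with
    | nil => simpa [tourLength] using h0
    | cons x l => have := h x; simp only [List.nil_append, tourLength]; omega
  | cons a l₁ ih =>
    cases l₁ with
    | nil => simp only [List.nil_append, List.cons_append, tourLength] at ih ⊢; omega
    | cons b l₁ => simp only [List.cons_append, tourLength] at ih ⊢; omega

theorem tourLength_eq_sum {V : Type*} (d : V → V → ℕ) (x : V) (l : List V) :
    tourLength d l = ∑ k ∈ Finset.range (l.length - 1), d (l.getD k x) (l.getD (k + 1) x) := by
  induction l with
  | nil => rfl
  | cons a l ih =>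
    cases l with
    | nil => rfl
    | cons b l =>
      rw [tourLength, ih]
      simp only [List.length_cons, Nat.add_sub_cancel]
      rw [Finset.sum_range_succ', add_comm (d a b)]
      rfl

/-- The points of a connected graph on `n` vertices can be listed so that the tour through them has
length at most `2 n`: insert the vertices one by one, each behind a neighbour. -/
theorem SimpleGraph.Connected.exists_short_tour {V : Type*} [Fintype V] {H : SimpleGraph V}
    (hH : H.Connected) :
    ∃ s : ℕ → V, (∀ v, ∃ k < Fintype.card V, s k = v) ∧
      ∑ k ∈ Finset.range (Fintype.card V - 1), H.dist (s k) (s (k + 1)) ≤ 2 * Fintype.card V := by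
  classical
  obtain ⟨x⟩ := hH.nonempty
  have key : ∀ k, k + 1 ≤ Fintype.card V → ∃ l : List V, l.Nodup ∧ l.length = k + 1 ∧
      tourLength H.dist l ≤ 2 * k := by
    intro k
    induction k with
    | zero => exact fun _ => ⟨[x], by simp, rfl, le_rfl⟩
    | succ k ih =>
      intro hk
      obtain ⟨l, hl, hlen, hc⟩ := ih (by omega)
      have hne : ∃ w, w ∉ l := by
        by_contra! hall
        have h1 : l.toFinset = Finset.univ := by ext w; simp [hall]
        have h2 := List.toFinset_card_of_nodup hl
        rw [h1, Finset.card_univ] at h2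
        omega
      obtain ⟨w, hw⟩ := hne
      have hy : ∃ y, y ∈ l := List.exists_mem_of_length_pos (by omega)
      obtain ⟨y, hy⟩ := hy
      obtain ⟨p⟩ := hH.preconnected y w
      obtain ⟨e, -, he1, he2⟩ := p.exists_boundary_dart {z | z ∈ l} hy hw
      obtain ⟨l₁, l₂, hl12⟩ := List.append_of_mem he1
      have hd : H.dist e.fst e.snd = 1 := SimpleGraph.dist_eq_one_iff_adj.2 e.adj
      refine ⟨l₁ ++ e.fst :: e.snd :: l₂, ?_, ?_, ?_⟩
      · have hperm : (l₁ ++ e.fst :: e.snd :: l₂).Perm (e.snd :: l) := by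
          rw [hl12]
          have : l₁ ++ e.fst :: e.snd :: l₂ = (l₁ ++ [e.fst]) ++ e.snd :: l₂ := by simp
          rw [this]
          refine List.perm_middle.trans ?_
          simp
        exact hperm.nodup_iff.2 (List.nodup_cons.2 ⟨he2, hl⟩)
      · rw [hl12] at hlen
        simp at hlen ⊢
        omega
      · refine (tourLength_insert_le H.dist (K := 2) (by omega) (fun z => ?_) l₁ l₂).trans ?_
        · have := hH.dist_triangle (u := e.snd) (v := e.fst) (w := z)
          rw [SimpleGraph.dist_comm (u := e.snd) (v := e.fst)] at this
          omega
        · rw [← hl12]; omega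
  have hpos : 0 < Fintype.card V := Fintype.card_pos_iff.2 ⟨x⟩
  obtain ⟨l, hl, hlen, hc⟩ := key (Fintype.card V - 1) (by omega)
  refine ⟨fun k => l.getD k x, fun v => ?_, ?_⟩
  · have hv : v ∈ l := by
      have h2 := List.toFinset_card_of_nodup hl
      have h1 : l.toFinset = Finset.univ := Finset.eq_univ_of_card _ (by omega)
      rw [← List.mem_toFinset, h1]; simp
    obtain ⟨k, hk, rfl⟩ := List.getElem_of_mem hv
    exact ⟨k, by omega, by simp [hk]⟩
  · rw [tourLength_eq_sum H.dist x, hlen] at hc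
    simp only [Nat.add_sub_cancel] at hc
    exact hc.trans (by omega)

/-! ### Reading off a local view -/

namespace LocalView

variable {L : Type}

open Classical in
/-- The label of the visible node with identity `a` (a default value if there is none). -/
noncomputable def labelOf [Inhabited L] (W : LocalView L) (a : ℕ) : L :=
  if h : ∃ l, ∃ s, (a, l, s) ∈ W.nodes then h.choose else default

open Classical in
/-- The certificate of the visible node with identity `a` (empty if there is none). -/
noncomputable def certOf (W : LocalView L) (a : ℕ) : List Bool :=
  if h : ∃ s, ∃ l, (a, l, s) ∈ W.nodes then h.choose else []

/-- The visible part of the network, as a graph on identities. -/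
def netGraph (W : LocalView L) : SimpleGraph ℕ :=
  SimpleGraph.fromRel fun a b => (a, b) ∈ W.edges

/-- The visible marked edges, as a graph on identities. -/
def spannerGraph (W : LocalView (Finset ℕ)) : SimpleGraph ℕ :=
  SimpleGraph.fromRel fun a b => W.netGraph.Adj a b ∧ b ∈ W.labelOf a

end LocalView

namespace LabeledNetwork

variable {L : Type} {c n : ℕ}

theorem self_mem_ball (I : LabeledNetwork L c n) (t : ℕ) (v : Fin n) : v ∈ I.ball t v := by
  simp [ball]

theorem mem_ball_of_adj (I : LabeledNetwork L c n) {t : ℕ} (ht : 1 ≤ t) {v u : Fin n}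
    (h : I.graph.Adj v u) : u ∈ I.ball t v := by
  simp only [ball, Set.mem_ofPred_eq, SimpleGraph.dist_eq_one_iff_adj.2 h, ht]

theorem labelOf_view [Inhabited L] (I : LabeledNetwork L c n) {t : ℕ} {cert : Fin n → List Bool}
    {v u : Fin n} (hu : u ∈ I.ball t v) : (I.view t cert v).labelOf (I.id u) = I.label u := by
  have h : ∃ l, ∃ s, (I.id u, l, s) ∈ (I.view t cert v).nodes := ⟨_, _, u, hu, rfl⟩
  rw [LocalView.labelOf, dif_pos h]
  obtain ⟨s, w, -, hs⟩ := h.choose_spec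
  simp only [Prod.mk.injEq] at hs
  rw [hs.2.1, I.id_injective hs.1]

theorem certOf_view (I : LabeledNetwork L c n) {t : ℕ} {cert : Fin n → List Bool}
    {v u : Fin n} (hu : u ∈ I.ball t v) : (I.view t cert v).certOf (I.id u) = cert u := by
  have h : ∃ s, ∃ l, (I.id u, l, s) ∈ (I.view t cert v).nodes := ⟨_, _, u, hu, rfl⟩
  rw [LocalView.certOf, dif_pos h]
  obtain ⟨s, w, -, hs⟩ := h.choose_spec
  simp only [Prod.mk.injEq] at hs
  rw [hs.2.2, I.id_injective hs.1]

theorem netGraph_view_adj (I : LabeledNetwork L c n) {t : ℕ} {cert : Fin n → List Bool}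
    {v : Fin n} {a b : ℕ} : (I.view t cert v).netGraph.Adj a b ↔
      ∃ u ∈ I.ball t v, ∃ w ∈ I.ball t v, I.graph.Adj u w ∧ a = I.id u ∧ b = I.id w := by
  simp only [LocalView.netGraph, SimpleGraph.fromRel_adj, view, Set.mem_ofPred_eq, Prod.mk.injEq]
  constructor
  · rintro ⟨-, ⟨u, hu, w, hw, h, h'⟩ | ⟨u, hu, w, hw, h, h'⟩⟩
    · exact ⟨u, hu, w, hw, h, h'⟩
    · exact ⟨w, hw, u, hu, h.symm, h'.2, h'.1⟩
  · rintro ⟨u, hu, w, hw, h, rfl, rfl⟩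
    exact ⟨fun e => h.ne (I.id_injective e), Or.inl ⟨u, hu, w, hw, h, rfl, rfl⟩⟩

/-- The marked edges that are edges of the network. -/
def spanner (I : LabeledNetwork (Finset ℕ) c n) : SimpleGraph (Fin n) :=
  markedGraph I ⊓ I.graph

theorem spannerGraph_view_adj (I : LabeledNetwork (Finset ℕ) c n) {t : ℕ}
    {cert : Fin n → List Bool} {v : Fin n} {a b : ℕ} :
    (I.view t cert v).spannerGraph.Adj a b ↔
      ∃ u ∈ I.ball t v, ∃ w ∈ I.ball t v, I.spanner.Adj u w ∧ a = I.id u ∧ b = I.id w := by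
  simp only [LocalView.spannerGraph, SimpleGraph.fromRel_adj, netGraph_view_adj, spanner,
    SimpleGraph.inf_adj, markedGraph]
  constructor
  · rintro ⟨-, ⟨⟨u, hu, w, hw, h, rfl, rfl⟩, h'⟩ | ⟨⟨u, hu, w, hw, h, rfl, rfl⟩, h'⟩⟩
    · rw [I.labelOf_view hu] at h'
      exact ⟨u, hu, w, hw, ⟨⟨h.ne, Or.inl h'⟩, h⟩, rfl, rfl⟩
    · rw [I.labelOf_view hu] at h'
      exact ⟨w, hw, u, hu, ⟨⟨h.ne', Or.inr h'⟩, h.symm⟩, rfl, rfl⟩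
  · rintro ⟨u, hu, w, hw, ⟨⟨h1, h2⟩, h⟩, rfl, rfl⟩
    refine ⟨fun e => h1 (I.id_injective e), ?_⟩
    rw [I.labelOf_view hu, I.labelOf_view hw]
    exact h2.imp (fun h2 => ⟨⟨u, hu, w, hw, h, rfl, rfl⟩, h2⟩)
      (fun h2 => ⟨⟨w, hw, u, hu, h.symm, rfl, rfl⟩, h2⟩)

theorem netGraph_view_adj_center (I : LabeledNetwork L c n) {t : ℕ} (ht : 1 ≤ t)
    {cert : Fin n → List Bool} {v : Fin n} {b : ℕ} :
    (I.view t cert v).netGraph.Adj (I.id v) b ↔ ∃ w, I.graph.Adj v w ∧ b = I.id w := by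
  rw [netGraph_view_adj]
  constructor
  · rintro ⟨u, -, w, -, h, h1, rfl⟩
    exact ⟨w, I.id_injective h1 ▸ h, rfl⟩
  · rintro ⟨w, h, rfl⟩
    exact ⟨v, I.self_mem_ball t v, w, I.mem_ball_of_adj ht h, h, rfl, rfl⟩

theorem spannerGraph_view_adj_center (I : LabeledNetwork (Finset ℕ) c n) {t : ℕ} (ht : 1 ≤ t)
    {cert : Fin n → List Bool} {v : Fin n} {b : ℕ} :
    (I.view t cert v).spannerGraph.Adj (I.id v) b ↔ ∃ w, I.spanner.Adj v w ∧ b = I.id w := by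
  rw [spannerGraph_view_adj]
  constructor
  · rintro ⟨u, -, w, -, h, h1, rfl⟩
    exact ⟨w, I.id_injective h1 ▸ h, rfl⟩
  · rintro ⟨w, h, rfl⟩
    exact ⟨v, I.self_mem_ball t v, w, I.mem_ball_of_adj ht h.2, h, rfl, rfl⟩

theorem spanner_eq_markedGraph (I : LabeledNetwork (Finset ℕ) c n)
    (h : ∀ v, ∀ i ∈ I.label v, ∃ w, I.graph.Adj v w ∧ I.id w = i) : I.spanner = markedGraph I := by
  refine inf_eq_left.2 fun v w hvw => ?_
  rcases (SimpleGraph.fromRel_adj _ _ _).1 hvw with ⟨-, h' | h'⟩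
  · obtain ⟨u, hu, hi⟩ := h _ _ h'
    exact I.id_injective hi ▸ hu
  · obtain ⟨u, hu, hi⟩ := h _ _ h'
    exact (I.id_injective hi ▸ hu).symm

end LabeledNetwork

/-! ### Potentials that certify a spanner -/

/-- The conditions that a node `v` checks on potentials `f` and `g` of its neighbourhood. Every
node `s` has an index `ι s`, and `K` is the set of indices that matter. The conditions force
`f · (ι s)` to be an upper bound for the distance to `s` in the spanner (it can only decrease to
`0` at a node of index `ι s`), and `g · (ι s)` to be a lower bound for the distance to `s` in the
network. The value `⊤` stands for an unknown distance. -/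
structure NodeCheck {c n : ℕ} (α β : ℕ) (I : LabeledNetwork (Finset ℕ) c n) (K : Set ℕ)
    (ι : Fin n → ℕ) (f g : Fin n → ℕ → ℕ∞) (v : Fin n) : Prop where
  label : ∀ i ∈ I.label v, ∃ w, I.graph.Adj v w ∧ I.id w = i
  index_mem : ι v ∈ K
  zero : g v (ι v) = 0
  lipschitz : ∀ k ∈ K, ∀ u, I.graph.Adj v u → g v k ≤ g u k + 1
  stretch : ∀ k ∈ K, f v k ≤ α * g v k + β
  source : ∀ k ∈ K, f v k = 0 → ι v = k
  descend : ∀ k ∈ K, f v k ≠ 0 → f v k ≠ ⊤ → ∃ u, I.spanner.Adj v u ∧ f u k + 1 ≤ f v k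

/-- The conditions of `NodeCheck` as a property of a local view, the potentials being given as
functions of the identity of a node. -/
structure LocalView.Check (W : LocalView (Finset ℕ)) (α β : ℕ) (K : Set ℕ) (ι : ℕ)
    (f g : ℕ → ℕ → ℕ∞) : Prop where
  label : ∀ i ∈ W.labelOf W.center, W.netGraph.Adj W.center i
  index_mem : ι ∈ K
  zero : g W.center ι = 0
  lipschitz : ∀ k ∈ K, ∀ b, W.netGraph.Adj W.center b → g W.center k ≤ g b k + 1
  stretch : ∀ k ∈ K, f W.center k ≤ α * g W.center k + β
  source : ∀ k ∈ K, f W.center k = 0 → ι = k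
  descend : ∀ k ∈ K, f W.center k ≠ 0 → f W.center k ≠ ⊤ →
    ∃ b, W.spannerGraph.Adj W.center b ∧ f b k + 1 ≤ f W.center k

section

variable {c n : ℕ} {α β : ℕ} {I : LabeledNetwork (Finset ℕ) c n} {K : Set ℕ} {ι : Fin n → ℕ}
  {f g : Fin n → ℕ → ℕ∞}

theorem check_view_iff {t : ℕ} (ht : 1 ≤ t) {cert : Fin n → List Bool} {v : Fin n}
    {f' g' : ℕ → ℕ → ℕ∞} (hf : ∀ u, I.graph.dist v u ≤ 1 → f' (I.id u) = f u)
    (hg : ∀ u, I.graph.dist v u ≤ 1 → g' (I.id u) = g u) :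
    (I.view t cert v).Check α β K (ι v) f' g' ↔ NodeCheck α β I K ι f g v := by
  have hc : (I.view t cert v).center = I.id v := rfl
  have hfv := hf v (by simp)
  have hgv := hg v (by simp)
  have hgu : ∀ u, I.graph.Adj v u → g' (I.id u) = g u :=
    fun u h => hg u (SimpleGraph.dist_eq_one_iff_adj.2 h).le
  have hfu : ∀ u, I.spanner.Adj v u → f' (I.id u) = f u :=
    fun u h => hf u (SimpleGraph.dist_eq_one_iff_adj.2 h.2).le
  constructor
  · rintro ⟨h1, h2, h3, h4, h5, h6, h7⟩
    rw [hc] at *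
    rw [hfv] at *
    rw [hgv] at *
    refine ⟨fun i hi => ?_, h2, h3, fun k hk u hu => ?_, h5, h6, fun k hk h0 ht' => ?_⟩
    · rw [I.labelOf_view (I.self_mem_ball t v)] at h1
      obtain ⟨w, hw, rfl⟩ := (I.netGraph_view_adj_center ht).1 (h1 i hi)
      exact ⟨w, hw, rfl⟩
    · rw [← hgu u hu]
      exact h4 k hk _ ((I.netGraph_view_adj_center ht).2 ⟨u, hu, rfl⟩)
    · obtain ⟨b, hb, hb'⟩ := h7 k hk h0 ht'
      obtain ⟨u, hu, rfl⟩ := (I.spannerGraph_view_adj_center ht).1 hb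
      exact ⟨u, hu, hfu u hu ▸ hb'⟩
  · rintro ⟨h1, h2, h3, h4, h5, h6, h7⟩
    refine ⟨fun i hi => ?_, h2, ?_, fun k hk b hb => ?_, ?_, ?_, fun k hk h0 ht' => ?_⟩
    · rw [hc, I.labelOf_view (I.self_mem_ball t v)] at hi
      obtain ⟨w, hw, rfl⟩ := h1 i hi
      exact (I.netGraph_view_adj_center ht).2 ⟨w, hw, rfl⟩
    · rw [hc, hgv, h3]
    · obtain ⟨u, hu, rfl⟩ := (I.netGraph_view_adj_center ht).1 hb
      rw [hc, hgv, hgu u hu]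
      exact h4 k hk u hu
    · rw [hc, hfv, hgv]; exact h5
    · rw [hc, hfv]; exact h6
    · rw [hc, hfv] at *
      obtain ⟨u, hu, hu'⟩ := h7 k hk h0 ht'
      exact ⟨I.id u, (I.spannerGraph_view_adj_center ht).2 ⟨u, hu, rfl⟩, by rwa [hfu u hu]⟩

theorem NodeCheck.exists_source (h : ∀ v, NodeCheck α β I K ι f g v) {k : ℕ} (hk : k ∈ K)
    (v : Fin n) (hv : f v k ≠ ⊤) : ∃ s, ι s = k ∧ I.spanner.edist v s ≤ f v k := by
  obtain ⟨m, hm⟩ := ENat.ne_top_iff_exists.1 hv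
  induction m using Nat.strong_induction_on generalizing v with
  | _ m ih =>
    by_cases h0 : f v k = 0
    · exact ⟨v, (h v).source k hk h0, by simp⟩
    · obtain ⟨u, hu, hle⟩ := (h v).descend k hk h0 hv
      have hu' : f u k ≠ ⊤ := by
        intro e
        rw [e, top_add, top_le_iff] at hle
        exact hv hle
      obtain ⟨m', hm'⟩ := ENat.ne_top_iff_exists.1 hu'
      have hlt : m' < m := by
        rw [← hm, ← hm'] at hle
        exact_mod_cast hle
      obtain ⟨s, hs, hd⟩ := ih m' hlt u hu' hm'
      refine ⟨s, hs, ?_⟩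
      calc I.spanner.edist v s ≤ I.spanner.edist v u + I.spanner.edist u s :=
            SimpleGraph.edist_triangle
        _ = 1 + I.spanner.edist u s := by rw [SimpleGraph.edist_eq_one_iff_adj.2 hu]
        _ ≤ f u k + 1 := by rw [add_comm]; gcongr
        _ ≤ f v k := hle

theorem NodeCheck.le_edist (h : ∀ v, NodeCheck α β I K ι f g v) (v s : Fin n) :
    g v (ι s) ≤ I.graph.edist v s := by
  obtain ⟨p, hp⟩ := I.connected.exists_walk_length_eq_edist v s
  rw [← hp]
  clear hp
  induction p with
  | nil => simp [(h _).zero]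
  | cons hadj p ih =>
    rw [SimpleGraph.Walk.length_cons, Nat.cast_add, Nat.cast_one]
    exact ((h _).lipschitz _ (h _).index_mem _ hadj).trans (by gcongr)

theorem edist_ne_top_of_network (u v : Fin n) : I.graph.edist u v ≠ ⊤ :=
  SimpleGraph.edist_ne_top_iff_reachable.2 (I.connected.preconnected u v)

theorem natCast_mul_add_ne_top {x : ℕ∞} (hx : x ≠ ⊤) (a b : ℕ) : (a : ℕ∞) * x + b ≠ ⊤ := by
  lift x to ℕ using hx
  exact_mod_cast ENat.natCast_ne_top (a * x + b)

theorem NodeCheck.ne_top (h : ∀ v, NodeCheck α β I K ι f g v) (v s : Fin n) :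
    f v (ι s) ≠ ⊤ := by
  intro e
  have h1 := (h v).stretch (ι s) (h s).index_mem
  have h2 : (α : ℕ∞) * g v (ι s) + β ≤ α * I.graph.edist v s + β := by
    gcongr; exact NodeCheck.le_edist h v s
  rw [e, top_le_iff] at h1
  rw [h1, top_le_iff] at h2
  exact natCast_mul_add_ne_top (edist_ne_top_of_network v s) _ _ h2

/-- If all nodes accept the potentials and the indices are distinct, then the marked edges form a
spanner. -/
theorem NodeCheck.isSpanner (h : ∀ v, NodeCheck α β I K ι f g v) (hι : Function.Injective ι) :
    IsSpanner α β I := by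
  have hlab : ∀ v, ∀ i ∈ I.label v, ∃ w, I.graph.Adj v w ∧ I.id w = i := fun v => (h v).label
  refine ⟨hlab, fun v s => ?_⟩
  obtain ⟨s', hs', hd⟩ := NodeCheck.exists_source h (h s).index_mem v (NodeCheck.ne_top h v s)
  rw [hι hs', I.spanner_eq_markedGraph hlab] at hd
  refine hd.trans (((h v).stretch _ (h s).index_mem).trans ?_)
  gcongr
  exact NodeCheck.le_edist h v s

theorem IsSpanner.spanner_connected (h : IsSpanner α β I) : I.spanner.Connected := by
  rw [I.spanner_eq_markedGraph h.1]
  have := I.connected.nonempty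
  refine ⟨fun u v => SimpleGraph.reachable_of_edist_ne_top fun e => ?_⟩
  have := h.2 u v
  rw [e, top_le_iff] at this
  exact natCast_mul_add_ne_top (edist_ne_top_of_network u v) _ _ this

/-- In a spanner the true distances pass all checks. -/
theorem IsSpanner.nodeCheck (hα : 1 ≤ α) (h : IsSpanner α β I) (hK : ∀ s, ι s ∈ K)
    (hf : ∀ v s, f v (ι s) = I.spanner.edist v s) (hg : ∀ v s, g v (ι s) = I.graph.edist v s)
    (hf' : ∀ v, ∀ k ∈ K, (∀ s, ι s ≠ k) → f v k = ⊤)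
    (hg' : ∀ v, ∀ k ∈ K, (∀ s, ι s ≠ k) → g v k = ⊤) (v : Fin n) :
    NodeCheck α β I K ι f g v := by
  have hcases : ∀ k, (∃ s, ι s = k) ∨ ∀ s, ι s ≠ k := fun k => by
    by_cases hk : ∃ s, ι s = k
    · exact Or.inl hk
    · exact Or.inr (by simpa using hk)
  refine ⟨h.1 v, hK v, by simp [hg], fun k hk u hu => ?_, fun k hk => ?_, fun k hk h0 => ?_,
    fun k hk h0 ht => ?_⟩
  · obtain ⟨s, rfl⟩ | hn := hcases k
    · rw [hg, hg, add_comm, ← SimpleGraph.edist_eq_one_iff_adj.2 hu]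
      exact SimpleGraph.edist_triangle
    · simp [hg' u k hk hn]
  · obtain ⟨s, rfl⟩ | hn := hcases k
    · rw [hf, hg, I.spanner_eq_markedGraph h.1]; exact h.2 v s
    · rw [hg' v k hk hn, ENat.mul_top (by exact_mod_cast (by omega : α ≠ 0))]; simp
  · obtain ⟨s, rfl⟩ | hn := hcases k
    · rw [hf, SimpleGraph.edist_eq_zero_iff] at h0; rw [h0]
    · rw [hf' v k hk hn] at h0; simp at h0
  · obtain ⟨s, rfl⟩ | hn := hcases k
    · rw [hf] at h0 ht
      obtain ⟨p, hp⟩ := SimpleGraph.exists_walk_of_edist_ne_top ht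
      cases p with
      | nil => simp at h0
      | cons hadj p =>
        refine ⟨_, hadj, ?_⟩
        rw [hf, hf, ← hp, SimpleGraph.Walk.length_cons, Nat.cast_add, Nat.cast_one]
        gcongr
        exact SimpleGraph.edist_le p
    · exact absurd (hf' v k hk hn) ht

end

/-! ### From certificates to schemes -/

/-- A verifier with certificates of at most `B n` bits for all instances with the property `P`
is part of a proof-labeling scheme of size at most `B n`. -/
theorem exists_prover {L : Type} {c t : ℕ} {P : ∀ n, LabeledNetwork L c n → Prop} {V : Verifier L}
    {B : ℕ → ℕ} (hc : ∀ n I, P n I → ∃ cert, Accepts V t I cert ∧ ∀ v, (cert v).length ≤ B n)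
    (hs : ∀ n (I : LabeledNetwork L c n) cert, Accepts V t I cert → P n I) :
    ∃ p : ∀ n, Prover L c n, (∀ n, IsPLS t (P n) (p n) V) ∧ ∀ n, certSize (P n) (p n) ≤ B n := by
  classical
  choose! p hp hB using hc
  refine ⟨p, fun n => ⟨fun I hI => hp n I hI, fun I hI cert ha => hI (hs n I cert ha)⟩, fun n => ?_⟩
  refine iSup_le fun I => iSup_le fun hI => iSup_le fun v => ?_
  exact_mod_cast hB n I hI v

/-! ### Counting the nodes with a tree -/

/-- If the counters of the children of every node sum up to less than its own counter, then there
are at most as many nodes as the counters of the nodes outside `S` (the roots) say. -/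
theorem card_le_sum_roots {V : Type*} [Fintype V] [DecidableEq V] (S : Finset V) (p : V → V)
    (cnt : V → ℕ) (h : ∀ v, 1 + ∑ u ∈ S with p u = v, cnt u ≤ cnt v) :
    Fintype.card V ≤ ∑ u ∈ Sᶜ, cnt u := by
  have h1 : ∑ v, (1 + ∑ u ∈ S with p u = v, cnt u) ≤ ∑ v, cnt v :=
    Finset.sum_le_sum fun v _ => h v
  rw [Finset.sum_add_distrib, Finset.sum_fiberwise] at h1
  rw [← Finset.sum_add_sum_compl S cnt] at h1
  simp only [Finset.sum_const, Finset.card_univ, smul_eq_mul, mul_one] at h1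
  omega

/-- The sizes of the subtrees of a tree: the recursion of `card_le_sum_roots` has a solution that
is bounded by the number of nodes. -/
theorem exists_subtree_sizes {V : Type*} [Fintype V] [DecidableEq V] (r : V) (p : V → V)
    (d : V → ℕ) (hd : ∀ u, u ≠ r → d (p u) < d u) :
    ∃ cnt : V → ℕ, (∀ v, 1 + ∑ u with u ≠ r ∧ p u = v, cnt u = cnt v) ∧
      ∀ v, cnt v ≤ Fintype.card V := by
  let c : ℕ → V → ℕ := fun m => Nat.rec (fun _ => 0)
    (fun _ c v => 1 + ∑ u with u ≠ r ∧ p u = v, c u) m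
  have hc : ∀ m v, c (m + 1) v = 1 + ∑ u with u ≠ r ∧ p u = v, c m u := fun _ _ => rfl
  obtain ⟨D, hD⟩ : ∃ D, ∀ v, d v ≤ D :=
    ⟨∑ v, d v, fun v => Finset.single_le_sum (fun _ _ => Nat.zero_le _) (Finset.mem_univ v)⟩
  have hstable : ∀ m v, D < m + d v → c (m + 1) v = c m v := by
    intro m
    induction m with
    | zero => intro v hv; have := hD v; omega
    | succ m ih =>
      intro v hv
      rw [hc (m + 1), hc m]
      congr 1
      refine Finset.sum_congr rfl fun u hu => ih u ?_
      simp only [Finset.mem_filter, Finset.mem_univ, true_and] at hu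
      have := hd u hu.1
      rw [hu.2] at this
      omega
  have heq : ∀ v, 1 + ∑ u with u ≠ r ∧ p u = v, c (D + 1) u = c (D + 1) v := fun v =>
    (hc (D + 1) v).symm.trans (hstable (D + 1) v (by omega))
  refine ⟨c (D + 1), heq, ?_⟩
  have hroot : c (D + 1) r = Fintype.card V := by
    have h1 : ∑ v, (1 + ∑ u with u ≠ r ∧ p u = v, c (D + 1) u) = ∑ v, c (D + 1) v :=
      Finset.sum_congr rfl fun v _ => heq v
    have h2 : ∀ v, ∑ u with u ≠ r ∧ p u = v, c (D + 1) u
        = ∑ u ∈ (Finset.univ.erase r) with p u = v, c (D + 1) u := fun v => by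
      congr 1; ext u; simp
    simp only [h2] at h1
    rw [Finset.sum_add_distrib, Finset.sum_fiberwise] at h1
    rw [← Finset.add_sum_erase _ (c (D + 1)) (Finset.mem_univ r)] at h1
    simp only [Finset.sum_const, Finset.card_univ, smul_eq_mul, mul_one] at h1
    omega
  have hle : ∀ m v, d v ≤ m → c (D + 1) v ≤ Fintype.card V := by
    intro m
    induction m with
    | zero =>
      intro v hv
      by_cases hvr : v = r
      · rw [hvr, hroot]
      · have := hd v hvr; omega
    | succ m ih =>
      intro v hv
      by_cases hvr : v = r
      · rw [hvr, hroot]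
      · refine le_trans ?_ (ih (p v) (by have := hd v hvr; omega))
        rw [← heq (p v)]
        refine le_add_left ?_
        exact Finset.single_le_sum (f := c (D + 1)) (fun _ _ => Nat.zero_le _) (by simp [hvr])
  exact fun v => hle _ v le_rfl

/-- Telescoping with truncated subtraction. -/
theorem sum_increments (x : ℕ → ℕ) (k : ℕ) :
    x 0 + ∑ i ∈ Finset.range k, (x (i + 1) - x i) - ∑ i ∈ Finset.range k, (x i - x (i + 1))
      = x k := by
  have : x 0 + ∑ i ∈ Finset.range k, (x (i + 1) - x i)
      = x k + ∑ i ∈ Finset.range k, (x i - x (i + 1)) := by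
    induction k with
    | zero => simp
    | succ k ih => rw [Finset.sum_range_succ, Finset.sum_range_succ]; omega
  omega

/-! ### Tables of four columns -/

/-- The first `m` rows of a table with four columns, as a list. -/
def tableList (T : ℕ → ℕ → ℕ) (m : ℕ) : List ℕ :=
  (List.range (4 * m)).map fun x => T (x / 4) (x % 4)

/-- The entry in row `i` and column `j`. -/
def readTable (l : List ℕ) (i j : ℕ) : ℕ := l.getD (4 * i + j) 0

theorem readTable_tableList (T : ℕ → ℕ → ℕ) {m i j : ℕ} (hi : i < m) (hj : j < 4) :
    readTable (tableList T m) i j = T i j := by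
  have h1 : 4 * i + j < 4 * m := by omega
  have h2 : (4 * i + j) / 4 = i := by omega
  have h3 : (4 * i + j) % 4 = j := by omega
  simp [readTable, tableList, h1, h2, h3]

theorem length_encodeList_tableList (T : ℕ → ℕ → ℕ) (m : ℕ) :
    (encodeList (tableList T m)).length =
      ∑ i ∈ Finset.range m, ∑ j ∈ Finset.range 4, (2 * (T i j).size + 1) := by
  rw [length_encodeList]
  induction m with
  | zero => rfl
  | succ m ih =>
    rw [Finset.sum_range_succ, ← ih]
    have h : ∀ j < 4, (4 * m + j) / 4 = m ∧ (4 * m + j) % 4 = j := fun j hj => by omega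
    simp only [tableList, show 4 * (m + 1) = 4 * m + 4 by ring, List.range_add, List.map_append,
      List.sum_append, List.map_map, Finset.sum_range_succ, Finset.sum_range_zero]
    congr 1
    simp [List.range_succ, (h 1 (by omega)), (h 2 (by omega)), (h 3 (by omega))]
    ring

theorem SimpleGraph.Connected.dist_le_card {V : Type*} [Fintype V] {G : SimpleGraph V}
    (hG : G.Connected) (u v : V) : G.dist u v ≤ Fintype.card V - 1 := by
  classical
  obtain ⟨p, hp, hl⟩ := hG.exists_path_of_dist u v
  have := hp.length_lt
  omega

/-! ### One round with certificates of linear size -/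

namespace RankScheme

/-- The entry in row `i` and column `j` of the table that a certificate encodes. The tables store the number of nodes and the identity of the root of a counting
tree (row 0, columns 0 and 1), the parent and the counter of the node (row 0, columns 2 and 3), the
rank of the node and its distances in the spanner and in the network to the node of rank 0 (row 1);
row `i + 2` holds the increments and the decrements of the two distances from rank `i` to
`i + 1`. -/
noncomputable def entry (s : List Bool) (i j : ℕ) : ℕ := readTable (decodeList s) i j

/-- The number of nodes that the certificate states. -/
noncomputable def size (s : List Bool) : ℕ := entry s 0 0

/-- The identity of the root of the counting tree. -/
noncomputable def root (s : List Bool) : ℕ := entry s 0 1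

/-- The identity of the parent in the counting tree. -/
noncomputable def parent (s : List Bool) : ℕ := entry s 0 2

/-- The counter of the node: the size of its subtree in the counting tree. -/
noncomputable def counter (s : List Bool) : ℕ := entry s 0 3

/-- The rank of the node in the common ordering of the nodes. -/
noncomputable def rank (s : List Bool) : ℕ := entry s 1 0

/-- The distance to the node of rank `k`: in the spanner for `j = 0`, in the network for `j = 1`. -/
noncomputable def potential (j : ℕ) (s : List Bool) (k : ℕ) : ℕ :=
  entry s 1 (1 + j) + ∑ i ∈ Finset.range k, entry s (i + 2) (2 * j)
    - ∑ i ∈ Finset.range k, entry s (i + 2) (2 * j + 1)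
open Classical in
/-- The conditions that a node checks. -/
structure NodeOK {c n : ℕ} (α β : ℕ) (I : LabeledNetwork (Finset ℕ) c n)
    (cert : Fin n → List Bool) (v : Fin n) : Prop where
  check : NodeCheck α β I {k | k < size (cert v)} (fun u => rank (cert u))
    (fun u k => (potential 0 (cert u) k : ℕ∞)) (fun u k => (potential 1 (cert u) k : ℕ∞)) v
  agree : ∀ u, I.graph.Adj v u → size (cert u) = size (cert v) ∧ root (cert u) = root (cert v)
  exists_parent : I.id v ≠ root (cert v) → ∃ u, I.graph.Adj v u ∧ parent (cert v) = I.id u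
  count : 1 + ∑ u with I.graph.Adj v u ∧ I.id u ≠ root (cert u) ∧ parent (cert u) = I.id v,
    counter (cert u) ≤ counter (cert v)
  count_root : I.id v = root (cert v) → counter (cert v) ≤ size (cert v)

/-- The conditions of `NodeOK`, read off the local view. -/
def verifier (α β : ℕ) : Verifier (Finset ℕ) := fun W =>
  W.Check α β {k | k < size (W.certOf W.center)} (rank (W.certOf W.center))
    (fun b k => (potential 0 (W.certOf b) k : ℕ∞))
    (fun b k => (potential 1 (W.certOf b) k : ℕ∞)) ∧
  (∀ b, W.netGraph.Adj W.center b → size (W.certOf b) = size (W.certOf W.center) ∧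
    root (W.certOf b) = root (W.certOf W.center)) ∧
  (W.center ≠ root (W.certOf W.center) →
    W.netGraph.Adj W.center (parent (W.certOf W.center))) ∧
  1 + ∑ᶠ b ∈ {b | W.netGraph.Adj W.center b ∧ b ≠ root (W.certOf b) ∧
      parent (W.certOf b) = W.center}, counter (W.certOf b) ≤ counter (W.certOf W.center) ∧
  (W.center = root (W.certOf W.center) →
    counter (W.certOf W.center) ≤ size (W.certOf W.center))

variable {c n : ℕ} {α β : ℕ} {I : LabeledNetwork (Finset ℕ) c n}

theorem verifier_view_iff {cert : Fin n → List Bool} {v : Fin n} :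
    verifier α β (I.view 1 cert v) ↔ NodeOK α β I cert v := by
  classical
  have hcen : (I.view 1 cert v).center = I.id v := rfl
  have hv : (I.view 1 cert v).certOf (I.id v) = cert v := I.certOf_view (I.self_mem_ball 1 v)
  have hu : ∀ u, I.graph.dist v u ≤ 1 → (I.view 1 cert v).certOf (I.id u) = cert u :=
    fun u h => I.certOf_view h
  have hadj : ∀ b, (I.view 1 cert v).netGraph.Adj (I.id v) b ↔ ∃ w, I.graph.Adj v w ∧ b = I.id w :=
    fun b => I.netGraph_view_adj_center le_rfl
  have hua : ∀ u, I.graph.Adj v u → (I.view 1 cert v).certOf (I.id u) = cert u :=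
    fun u h => hu u (SimpleGraph.dist_eq_one_iff_adj.2 h).le
  have hset : {b | (I.view 1 cert v).netGraph.Adj (I.id v) b ∧
      b ≠ root ((I.view 1 cert v).certOf b) ∧ parent ((I.view 1 cert v).certOf b) = I.id v} =
      I.id '' ↑({u | I.graph.Adj v u ∧ I.id u ≠ root (cert u) ∧ parent (cert u) = I.id v} :
        Finset (Fin n)) := by
    ext b
    simp only [hadj, Set.mem_ofPred_eq, Set.mem_image, Finset.coe_filter, Finset.mem_univ,
      true_and]
    constructor
    · rintro ⟨⟨w, hw, rfl⟩, h2, h3⟩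
      rw [hua w hw] at h2 h3
      exact ⟨w, ⟨hw, h2, h3⟩, rfl⟩
    · rintro ⟨w, ⟨hw, h2, h3⟩, rfl⟩
      rw [hua w hw]
      exact ⟨⟨w, hw, rfl⟩, h2, h3⟩
  have hsum : ∑ᶠ b ∈ {b | (I.view 1 cert v).netGraph.Adj (I.id v) b ∧
      b ≠ root ((I.view 1 cert v).certOf b) ∧ parent ((I.view 1 cert v).certOf b) = I.id v},
      counter ((I.view 1 cert v).certOf b) =
      ∑ u with I.graph.Adj v u ∧ I.id u ≠ root (cert u) ∧ parent (cert u) = I.id v,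
        counter (cert u) := by
    rw [hset, finsum_mem_image I.id_injective.injOn, finsum_mem_coe_finset]
    refine Finset.sum_congr rfl fun u hu' => ?_
    rw [hua u (Finset.mem_filter.1 hu').2.1]
  have hcheck := check_view_iff (α := α) (β := β) (I := I) (t := 1) (cert := cert) (v := v)
    (K := {k | k < size (cert v)}) (ι := fun u => rank (cert u)) le_rfl
    (f := fun u k => (potential 0 (cert u) k : ℕ∞)) (g := fun u k => (potential 1 (cert u) k : ℕ∞))
    (f' := fun b k => (potential 0 ((I.view 1 cert v).certOf b) k : ℕ∞))
    (g' := fun b k => (potential 1 ((I.view 1 cert v).certOf b) k : ℕ∞))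
    (fun u h => by simp only [hu u h]) (fun u h => by simp only [hu u h])
  unfold verifier
  rw [hcen, hv, hsum, hcheck]
  constructor
  · rintro ⟨h1, h2, h3, h4, h5⟩
    refine ⟨h1, fun u hvu => ?_, fun h => (hadj _).1 (h3 h), h4, h5⟩
    have := h2 (I.id u) ((hadj _).2 ⟨u, hvu, rfl⟩)
    rwa [hua u hvu] at this
  · rintro ⟨h1, h2, h3, h4, h5⟩
    refine ⟨h1, fun b hb => ?_, fun h => (hadj _).2 (h3 h), h4, h5⟩
    obtain ⟨u, hvu, rfl⟩ := (hadj b).1 hb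
    rw [hua u hvu]
    exact h2 u hvu

theorem sound {cert : Fin n → List Bool} (h : Accepts (verifier α β) 1 I cert) :
    IsSpanner α β I := by
  classical
  have hok : ∀ v, NodeOK α β I cert v := fun v => verifier_view_iff.1 (h v)
  obtain ⟨v₀⟩ := I.connected.nonempty
  have hagree : ∀ v, size (cert v) = size (cert v₀) ∧ root (cert v) = root (cert v₀) := by
    intro v
    obtain ⟨p⟩ := I.connected.preconnected v v₀
    induction p with
    | nil => exact ⟨rfl, rfl⟩
    | cons hadj p ih =>
      have := (hok _).agree _ hadj
      exact ⟨this.1 ▸ ih.1, this.2 ▸ ih.2⟩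
  have hcheck : ∀ v, NodeCheck α β I {k | k < size (cert v₀)} (fun u => rank (cert u))
      (fun u k => (potential 0 (cert u) k : ℕ∞)) (fun u k => (potential 1 (cert u) k : ℕ∞)) v :=
    fun v => (hagree v).1 ▸ (hok v).check
  -- the tree shows that there are at most as many nodes as ranks
  have hcard : n ≤ size (cert v₀) := by
    let p : Fin n → Fin n := fun v =>
      if hv : I.id v ≠ root (cert v) then ((hok v).exists_parent hv).choose else v
    have hp : ∀ v, I.id v ≠ root (cert v) →
        I.graph.Adj v (p v) ∧ parent (cert v) = I.id (p v) := fun v hv => by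
      simp only [p, dif_pos hv]; exact ((hok v).exists_parent hv).choose_spec
    have hle := card_le_sum_roots (Finset.univ.filter fun u => I.id u ≠ root (cert u)) p
      (fun u => counter (cert u)) (fun v => by
        refine le_trans ?_ (hok v).count
        gcongr 1 + ?_
        refine Finset.sum_le_sum_of_subset fun u hu => ?_
        simp only [Finset.mem_filter, Finset.mem_univ, true_and] at hu ⊢
        obtain ⟨h1, h2⟩ := hp u hu.1
        rw [hu.2] at h1 h2
        exact ⟨h1.symm, hu.1, h2⟩)
    rw [Fintype.card_fin] at hle
    refine hle.trans ?_
    by_cases hr : ∃ r, I.id r = root (cert r)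
    · obtain ⟨r, hr⟩ := hr
      have hsub : (Finset.univ.filter fun u => I.id u ≠ root (cert u))ᶜ ⊆ {r} := fun u hu => by
        simp only [Finset.mem_compl, Finset.mem_filter, Finset.mem_univ, true_and, not_not] at hu
        rw [Finset.mem_singleton]
        exact I.id_injective (by rw [hu, hr, (hagree u).2, (hagree r).2])
      refine (Finset.sum_le_sum_of_subset hsub).trans ?_
      rw [Finset.sum_singleton, ← (hagree r).1]
      exact (hok r).count_root hr
    · rw [Finset.sum_eq_zero]
      · exact Nat.zero_le _
      · intro u hu
        simp only [Finset.mem_compl, Finset.mem_filter, Finset.mem_univ, true_and, not_not] at hu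
        exact absurd ⟨u, hu⟩ hr
  -- every rank is taken, since its potential leads to a node of this rank
  have hsurj : Finset.range (size (cert v₀)) ⊆ Finset.univ.image fun u => rank (cert u) := by
    intro k hk
    obtain ⟨s, hs, -⟩ := NodeCheck.exists_source hcheck (k := k) (Finset.mem_range.1 hk) v₀
      (ENat.natCast_ne_top _)
    exact Finset.mem_image.2 ⟨s, Finset.mem_univ _, hs⟩
  have hinj : Function.Injective fun u => rank (cert u) := by
    have h1 := Finset.card_le_card hsurj
    rw [Finset.card_range] at h1
    have h2 : (Finset.univ.image fun u => rank (cert u)).card = (Finset.univ : Finset (Fin n)).card :=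
      le_antisymm Finset.card_image_le (by rw [Finset.card_univ, Fintype.card_fin]; omega)
    exact fun a b hab => Finset.card_image_iff.1 h2 (by simp) (by simp) hab
  exact NodeCheck.isSpanner hcheck hinj

/-- The certificate table of a node with the given data. -/
def table (N R par cnt rk : ℕ) (dH dG : ℕ → ℕ) : ℕ → ℕ → ℕ
  | 0, 0 => N
  | 0, 1 => R
  | 0, 2 => par
  | 0, 3 => cnt
  | 1, 0 => rk
  | 1, 1 => dH 0
  | 1, 2 => dG 0
  | i + 2, 0 => dH (i + 1) - dH i
  | i + 2, 1 => dH i - dH (i + 1)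
  | i + 2, 2 => dG (i + 1) - dG i
  | i + 2, 3 => dG i - dG (i + 1)
  | _, _ => 0

theorem length_table_le {N R par cnt rk : ℕ} {dH dG : ℕ → ℕ} {n c : ℕ} (hn : 1 ≤ n)
    (hN : N ≤ n) (hR : R ≤ n ^ c) (hpar : par ≤ n ^ c) (hcnt : cnt ≤ n) (hrk : rk ≤ n)
    (hH : dH 0 ≤ n) (hG : dG 0 ≤ n)
    (hvH : ∑ i ∈ Finset.range (n - 1), (dH (i + 1) - dH i + (dH i - dH (i + 1))) ≤ 2 * n)
    (hvG : ∑ i ∈ Finset.range (n - 1), (dG (i + 1) - dG i + (dG i - dG (i + 1))) ≤ 2 * n) :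
    (encodeList (tableList (table N R par cnt rk dH dG) (n + 1))).length ≤ (40 + 4 * c) * n := by
  rw [length_encodeList_tableList]
  obtain ⟨m, rfl⟩ : ∃ m, n = m + 1 := ⟨n - 1, by omega⟩
  rw [Finset.sum_range_succ', Finset.sum_range_succ', Nat.add_sub_cancel] at *
  have hsz : ∀ x, x ≤ (m + 1) ^ c → x.size ≤ c * (m + 1) + 1 := fun x hx =>
    (Nat.size_le_size hx).trans ((Nat.size_pow_le _ _).trans (by gcongr; exact Nat.size_le_self _))
  have h1 := hsz R hR
  have h2 := hsz par hpar
  have h3 := Nat.size_le_self N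
  have h4 := Nat.size_le_self cnt
  have h5 := Nat.size_le_self rk
  have h6 := Nat.size_le_self (dH 0)
  have h7 := Nat.size_le_self (dG 0)
  have hrows : ∑ i ∈ Finset.range m, ∑ j ∈ Finset.range 4,
      (2 * (table N R par cnt rk dH dG (i + 1 + 1) j).size + 1) ≤
      ∑ i ∈ Finset.range m, (4 + 2 * (dH (i + 1) - dH i + (dH i - dH (i + 1))) +
        2 * (dG (i + 1) - dG i + (dG i - dG (i + 1)))) := by
    refine Finset.sum_le_sum fun i _ => ?_
    simp only [Finset.sum_range_succ, Finset.sum_range_zero, table]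
    have := Nat.size_le_self (dH (i + 1) - dH i)
    have := Nat.size_le_self (dH i - dH (i + 1))
    have := Nat.size_le_self (dG (i + 1) - dG i)
    have := Nat.size_le_self (dG i - dG (i + 1))
    omega
  rw [Finset.sum_add_distrib, Finset.sum_add_distrib, ← Finset.mul_sum, ← Finset.mul_sum,
    Finset.sum_const, Finset.card_range, smul_eq_mul] at hrows
  simp only [Finset.sum_range_succ (n := 3), Finset.sum_range_succ (n := 2),
    Finset.sum_range_succ (n := 1), Finset.sum_range_succ (n := 0), Finset.sum_range_zero,
    Nat.size_zero, table] at hrows ⊢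
  have hmul : (40 + 4 * c) * (m + 1) = 40 * (m + 1) + 4 * (c * (m + 1)) := by ring
  omega

theorem complete (hα : 1 ≤ α) (hI : IsSpanner α β I) : ∃ cert,
    Accepts (verifier α β) 1 I cert ∧ ∀ v, (cert v).length ≤ (40 + 4 * c) * n := by
  classical
  have hH := hI.spanner_connected
  obtain ⟨s, hs, htour⟩ := hH.exists_short_tour
  rw [Fintype.card_fin] at hs htour
  choose rk hrk hrks using hs
  obtain ⟨r⟩ := I.connected.nonempty
  have hn : 1 ≤ n := by have := r.2; omega
  -- parents in a breadth-first search tree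
  have hpar : ∀ u, ∃ p, u ≠ r → I.graph.Adj u p ∧ I.graph.dist p r < I.graph.dist u r := by
    intro u
    by_cases hu : u = r
    · exact ⟨u, fun h => absurd hu h⟩
    · obtain ⟨p, hp⟩ := I.connected.exists_walk_length_eq_dist u r
      cases p with
      | nil => exact absurd rfl hu
      | cons hadj q =>
        refine ⟨_, fun _ => ⟨hadj, ?_⟩⟩
        rw [← hp, SimpleGraph.Walk.length_cons]
        exact Nat.lt_succ_of_le (SimpleGraph.dist_le q)
  choose par hpar using hpar
  obtain ⟨cnt, hcnt, hcntn⟩ := exists_subtree_sizes r par (fun u => I.graph.dist u r)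
    (fun u hu => (hpar u hu).2)
  rw [Fintype.card_fin] at hcntn
  let T : Fin n → ℕ → ℕ → ℕ := fun v => table n (I.id r) (I.id (par v)) (cnt v) (rk v)
    (fun i => I.spanner.dist v (s i)) (fun i => I.graph.dist v (s i))
  let cert : Fin n → List Bool := fun v => encodeList (tableList (T v) (n + 1))
  have hentry : ∀ v i j, i < n + 1 → j < 4 → entry (cert v) i j = T v i j := fun v i j hi hj => by
    simp only [entry, cert, decodeList_encodeList, readTable_tableList _ hi hj]
  have hsize : ∀ v, size (cert v) = n := fun v => hentry v 0 0 (by omega) (by omega)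
  have hroot : ∀ v, root (cert v) = I.id r := fun v => hentry v 0 1 (by omega) (by omega)
  have hparent : ∀ v, parent (cert v) = I.id (par v) := fun v =>
    hentry v 0 2 (by omega) (by omega)
  have hcounter : ∀ v, counter (cert v) = cnt v := fun v => hentry v 0 3 (by omega) (by omega)
  have hrank : ∀ v, rank (cert v) = rk v := fun v => hentry v 1 0 (by omega) (by omega)
  have hpotH : ∀ v k, k < n → potential 0 (cert v) k = I.spanner.dist v (s k) := by
    intro v k hk
    rw [← sum_increments (fun i => I.spanner.dist v (s i)) k, potential,
      hentry v 1 1 (by omega) (by omega)]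
    congr 1
    · congr 1
      refine Finset.sum_congr rfl fun i hi => ?_
      rw [Finset.mem_range] at hi
      exact hentry v (i + 2) 0 (by omega) (by omega)
    · refine Finset.sum_congr rfl fun i hi => ?_
      rw [Finset.mem_range] at hi
      exact hentry v (i + 2) 1 (by omega) (by omega)
  have hpotG : ∀ v k, k < n → potential 1 (cert v) k = I.graph.dist v (s k) := by
    intro v k hk
    rw [← sum_increments (fun i => I.graph.dist v (s i)) k, potential,
      hentry v 1 2 (by omega) (by omega)]
    congr 1
    · congr 1
      refine Finset.sum_congr rfl fun i hi => ?_
      rw [Finset.mem_range] at hi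
      exact hentry v (i + 2) 2 (by omega) (by omega)
    · refine Finset.sum_congr rfl fun i hi => ?_
      rw [Finset.mem_range] at hi
      exact hentry v (i + 2) 3 (by omega) (by omega)
  have hrk_surj : ∀ k < n, ∃ u, rk u = k := by
    have hinj : Function.Injective fun u => (⟨rk u, hrk u⟩ : Fin n) := fun a b hab => by
      rw [← hrks a, ← hrks b, Fin.mk.inj_iff.1 hab]
    intro k hk
    obtain ⟨u, hu⟩ := Finite.injective_iff_surjective.1 hinj ⟨k, hk⟩
    exact ⟨u, Fin.mk.inj_iff.1 hu⟩
  refine ⟨cert, fun v => verifier_view_iff.2 ⟨?_, fun u _ => ?_, fun hv => ?_, ?_, fun _ => ?_⟩,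
    fun v => ?_⟩
  · refine hI.nodeCheck hα (fun u => ?_) (fun u w => ?_) (fun u w => ?_) (fun u k hk hno => ?_)
      (fun u k hk hno => ?_) v
    · simp only [Set.mem_ofPred_eq, hsize, hrank, hrk]
    · rw [hrank, hpotH u _ (hrk w), hrks]
      exact (hH.preconnected u w).coe_dist_eq_edist
    · rw [hrank, hpotG u _ (hrk w), hrks]
      exact (I.connected.preconnected u w).coe_dist_eq_edist
    · obtain ⟨w, hw⟩ := hrk_surj k (by simpa [hsize] using hk)
      exact absurd ((hrank w).trans hw) (hno w)
    · obtain ⟨w, hw⟩ := hrk_surj k (by simpa [hsize] using hk)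
      exact absurd ((hrank w).trans hw) (hno w)
  · rw [hsize, hsize, hroot, hroot]; exact ⟨rfl, rfl⟩
  · rw [hroot] at hv
    exact ⟨par v, (hpar v fun e => hv (by rw [e])).1, hparent v⟩
  · rw [hcounter, ← hcnt v]
    gcongr 1 + ?_
    simp only [hcounter]
    refine Finset.sum_le_sum_of_subset fun u hu => ?_
    simp only [Finset.mem_filter, Finset.mem_univ, true_and, hroot, hparent] at hu ⊢
    exact ⟨fun e => hu.2.1 (by rw [e]), I.id_injective hu.2.2⟩
  · rw [hcounter, hsize]; exact hcntn v
  · have hdle : ∀ u w, I.graph.dist u w ≤ I.spanner.dist u w := fun u w =>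
      SimpleGraph.Reachable.dist_anti inf_le_right (hH.preconnected u w)
    have hn1 : ∀ u w, I.spanner.dist u w ≤ n := fun u w => by
      have := hH.dist_le_card u w
      rw [Fintype.card_fin] at this
      omega
    refine length_table_le hn le_rfl (I.id_le r) (I.id_le _) (hcntn v) (hrk v).le (hn1 _ _)
      ((hdle _ _).trans (hn1 _ _)) ?_ ?_
    · refine le_trans (Finset.sum_le_sum fun i _ => ?_) htour
      have h1 := hH.dist_triangle (u := v) (v := s i) (w := s (i + 1))
      have h2 := hH.dist_triangle (u := v) (v := s (i + 1)) (w := s i)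
      rw [SimpleGraph.dist_comm (u := s (i + 1)) (v := s i)] at h2
      omega
    · refine le_trans (Finset.sum_le_sum fun i _ => ?_) htour
      have h1 := I.connected.dist_triangle (u := v) (v := s i) (w := s (i + 1))
      have h2 := I.connected.dist_triangle (u := v) (v := s (i + 1)) (w := s i)
      rw [SimpleGraph.dist_comm (u := s (i + 1)) (v := s i)] at h2
      have h3 := hdle (s i) (s (i + 1))
      omega

end RankScheme

/-- Certificates of linear size suffice for one round. -/
theorem exists_linear_scheme (c : ℕ) {α : ℕ} (hα : 1 ≤ α) (β : ℕ) :
    ∃ (p : ∀ n, Prover (Finset ℕ) c n) (V : Verifier (Finset ℕ)),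
      (∀ n, IsPLS 1 (IsSpanner α β) (p n) V) ∧
      ∀ n, certSize (IsSpanner α β) (p n) ≤ ((40 + 4 * c) * n : ℕ) := by
  obtain ⟨p, h1, h2⟩ := exists_prover (P := fun n => IsSpanner α β (c := c) (n := n))
    (V := RankScheme.verifier α β) (B := fun n => (40 + 4 * c) * n)
    (fun n I hI => RankScheme.complete hα hI) (fun n I cert h => RankScheme.sound h)
  exact ⟨p, _, h1, h2⟩

/-! ### Estimating distances from sparse information -/

/-- The estimate at `u` for the distance to the node of index `k`: the cheapest way to walk less
than `t` steps to a node `w` and to continue with a known distance `x` from there. -/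
noncomputable def estimate {V : Type*} (G : SimpleGraph V) (S : V → ℕ → ℕ → Prop) (t : ℕ) (u : V)
    (k : ℕ) : ℕ∞ :=
  ⨅ (w : V) (m : ℕ) (x : ℕ) (_ : m < t ∧ (∃ p : G.Walk u w, p.length = m) ∧ S w k x),
    ((m + x : ℕ) : ℕ∞)

theorem le_estimate_iff {V : Type*} {G : SimpleGraph V} {S : V → ℕ → ℕ → Prop} {t : ℕ} {u : V}
    {k : ℕ} {a : ℕ∞} : a ≤ estimate G S t u k ↔
      ∀ w m x, m < t → (∃ p : G.Walk u w, p.length = m) → S w k x → a ≤ (m + x : ℕ) := by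
  simp only [estimate, le_iInf_iff]
  exact ⟨fun h w m x h1 h2 h3 => h w m x ⟨h1, h2, h3⟩, fun h w m x h' => h w m x h'.1 h'.2.1 h'.2.2⟩

theorem estimate_le {V : Type*} {G : SimpleGraph V} {S : V → ℕ → ℕ → Prop} {t : ℕ} {u : V}
    {k : ℕ} {w : V} {x : ℕ} (p : G.Walk u w) (hp : p.length < t) (hx : S w k x) :
    estimate G S t u k ≤ (p.length + x : ℕ) :=
  le_estimate_iff.1 le_rfl w _ x hp ⟨p, rfl⟩ hx

/-- It suffices that the distance to `s` is known at the nodes whose distance to `s` lies in one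
residue class modulo `t`: every geodesic to `s` meets such a node, or `s` itself, within `t - 1`
steps. -/
theorem estimate_eq_edist {V : Type*} {G : SimpleGraph V} (hG : G.Connected)
    {S : V → ℕ → ℕ → Prop} {t : ℕ} {u s : V} {k r : ℕ} (ht : 1 ≤ t)
    (hS : ∀ w x, S w k x → x = G.dist w s) (hself : S s k 0)
    (hstore : ∀ w, t ≤ G.dist u s → G.dist w s ≡ r [MOD t] → S w k (G.dist w s)) :
    estimate G S t u k = G.edist u s := by
  refine le_antisymm ?_ (le_estimate_iff.2 ?_)
  · obtain ⟨p, hp⟩ := hG.exists_walk_length_eq_dist u s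
    rw [← (hG.preconnected u s).coe_dist_eq_edist]
    by_cases hd : G.dist u s < t
    · have := estimate_le p (hp.trans_lt hd) hself
      rwa [hp, add_zero] at this
    · rw [not_lt] at hd
      have hr : r % t < t := Nat.mod_lt _ ht
      obtain ⟨q, hq⟩ : ∃ q, (G.dist u s - r % t) = t * q + (G.dist u s - r % t) % t :=
        ⟨_, (Nat.div_add_mod _ _).symm⟩
      set m := (G.dist u s - r % t) % t with hm
      have hmt : m < t := Nat.mod_lt _ ht
      have hlen : (p.take m).length = m := by rw [SimpleGraph.Walk.take_length]; omega
      have hw : G.dist (p.getVert m) s = G.dist u s - m := by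
        have h1 := SimpleGraph.dist_le (p.drop m)
        rw [SimpleGraph.Walk.drop_length, hp] at h1
        have h2 := SimpleGraph.dist_le (p.take m)
        have h3 := hG.dist_triangle (u := u) (v := p.getVert m) (w := s)
        omega
      have hmod : G.dist (p.getVert m) s ≡ r [MOD t] := by
        rw [hw, show G.dist u s - m = r % t + t * q by omega]
        simp [Nat.ModEq]
      have := estimate_le (p.take m) (hlen.trans_lt hmt) (hstore _ hd hmod)
      rwa [hlen, hw, Nat.add_sub_cancel' (by omega)] at this
  · rintro w m x - ⟨p, rfl⟩ hx
    rw [hS w x hx, Nat.cast_add, (hG.preconnected w s).coe_dist_eq_edist]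
    exact SimpleGraph.edist_triangle.trans (by gcongr; exact SimpleGraph.edist_le p)

theorem estimate_eq_top {V : Type*} {G : SimpleGraph V} {S : V → ℕ → ℕ → Prop} {t : ℕ} {u : V}
    {k : ℕ} (h : ∀ w x, ¬ S w k x) : estimate G S t u k = ⊤ :=
  top_le_iff.1 (le_estimate_iff.2 fun w _ x _ _ hx => absurd hx (h w x))

theorem SimpleGraph.exists_walk_length_succ_iff {V : Type*} {G : SimpleGraph V} {a b : V} {m : ℕ} :
    (∃ p : G.Walk a b, p.length = m + 1) ↔ ∃ x, G.Adj a x ∧ ∃ p : G.Walk x b, p.length = m := by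
  constructor
  · rintro ⟨p, hp⟩
    cases p with
    | nil => simp at hp
    | cons h q => exact ⟨_, h, q, by simpa using hp⟩
  · rintro ⟨x, h, q, rfl⟩
    exact ⟨.cons h q, rfl⟩

section

variable {L : Type} {c n : ℕ} {I : LabeledNetwork L c n}

/-- Walks that stay in the ball can be followed in the view. -/
theorem exists_walk_view_iff {t : ℕ} {v : Fin n} {G : SimpleGraph (Fin n)} (hG : G ≤ I.graph)
    {H : SimpleGraph ℕ} (hH : ∀ {a b}, H.Adj a b ↔
      ∃ u ∈ I.ball t v, ∃ w ∈ I.ball t v, G.Adj u w ∧ a = I.id u ∧ b = I.id w)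
    {m : ℕ} {u : Fin n} (hu : I.graph.dist v u + m ≤ t) {b : ℕ} :
    (∃ p : H.Walk (I.id u) b, p.length = m) ↔
      ∃ w, b = I.id w ∧ ∃ p : G.Walk u w, p.length = m := by
  induction m generalizing u with
  | zero =>
    constructor
    · rintro ⟨p, hp⟩
      exact ⟨u, (SimpleGraph.Walk.eq_of_length_eq_zero hp).symm, .nil, rfl⟩
    · rintro ⟨w, rfl, p, hp⟩
      obtain rfl := SimpleGraph.Walk.eq_of_length_eq_zero hp
      exact ⟨.nil, rfl⟩
  | succ m ih =>
    have hstep : ∀ u', G.Adj u u' → I.graph.dist v u' + m ≤ t := fun u' h => by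
      have := I.connected.dist_triangle (u := v) (v := u) (w := u')
      rw [SimpleGraph.dist_eq_one_iff_adj.2 (hG h)] at this
      omega
    rw [SimpleGraph.exists_walk_length_succ_iff]
    constructor
    · rintro ⟨x, hx, hp⟩
      obtain ⟨u₁, -, u₂, -, h, h1, rfl⟩ := hH.1 hx
      obtain rfl := I.id_injective h1
      obtain ⟨w, hw, hp⟩ := (ih (hstep _ h)).1 hp
      exact ⟨w, hw, SimpleGraph.exists_walk_length_succ_iff.2 ⟨u₂, h, hp⟩⟩
    · rintro ⟨w, rfl, hp⟩
      obtain ⟨u', h, hp⟩ := SimpleGraph.exists_walk_length_succ_iff.1 hp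
      have h1 := hstep u' h
      refine ⟨I.id u', hH.2 ⟨u, ?_, u', ?_, h, rfl, rfl⟩, (ih h1).2 ⟨w, rfl, hp⟩⟩
      · exact show I.graph.dist v u ≤ t by omega
      · exact show I.graph.dist v u' ≤ t by omega

/-- The estimates of the neighbours can be computed from the view. -/
theorem estimate_view {t : ℕ} {v : Fin n} {G : SimpleGraph (Fin n)} (hG : G ≤ I.graph)
    {H : SimpleGraph ℕ} (hH : ∀ {a b}, H.Adj a b ↔
      ∃ u ∈ I.ball t v, ∃ w ∈ I.ball t v, G.Adj u w ∧ a = I.id u ∧ b = I.id w)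
    {S : Fin n → ℕ → ℕ → Prop} {S' : ℕ → ℕ → ℕ → Prop}
    (hS : ∀ w ∈ I.ball t v, S' (I.id w) = S w) {u : Fin n} (hu : I.graph.dist v u ≤ 1) :
    estimate H S' t (I.id u) = estimate G S t u := by
  have hball : ∀ w (p : G.Walk u w), p.length < t → w ∈ I.ball t v := fun w p hp => by
    have h1 := I.connected.dist_triangle (u := v) (v := u) (w := w)
    have h2 := SimpleGraph.dist_le (p.map (SimpleGraph.Hom.ofLE hG))
    rw [SimpleGraph.Walk.length_map] at h2
    simp only [SimpleGraph.Hom.coe_ofLE, id_eq] at h2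
    exact show I.graph.dist v w ≤ t by omega
  funext k
  refine le_antisymm (le_estimate_iff.2 ?_) (le_estimate_iff.2 ?_)
  · rintro w m x hm ⟨p, rfl⟩ hx
    refine le_estimate_iff.1 le_rfl (I.id w) _ x hm ?_ ?_
    · exact (exists_walk_view_iff hG hH (by omega)).2 ⟨w, rfl, p, rfl⟩
    · rwa [hS w (hball w p hm)]
  · rintro b m x hm hp hx
    obtain ⟨w, rfl, p, rfl⟩ := (exists_walk_view_iff hG hH (by omega)).1 hp
    rw [hS w (hball w p hm)] at hx
    exact estimate_le p hm hx

end

/-! ### Spreading the information -/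

/-- In a connected graph on `n` vertices, the vertices can be placed on a line of length `2 n` such
that distances do not increase from the line to the graph. -/
theorem SimpleGraph.Connected.exists_line_placement {V : Type*} [Fintype V] {H : SimpleGraph V}
    (hH : H.Connected) : ∃ pos : V → ℕ, (∀ v, pos v ≤ 2 * Fintype.card V) ∧
      ∀ u v, pos u ≤ pos v → H.dist u v ≤ pos v - pos u := by
  obtain ⟨s, hs, htour⟩ := hH.exists_short_tour
  choose rk hrk hrks using hs
  have hmono : ∀ i j, i ≤ j → ∑ k ∈ Finset.range i, H.dist (s k) (s (k + 1)) ≤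
      ∑ k ∈ Finset.range j, H.dist (s k) (s (k + 1)) := fun i j hij =>
    Finset.sum_le_sum_of_subset (by simpa using hij)
  have hdist : ∀ i j, i ≤ j → H.dist (s i) (s j) + ∑ k ∈ Finset.range i, H.dist (s k) (s (k + 1))
      ≤ ∑ k ∈ Finset.range j, H.dist (s k) (s (k + 1)) := by
    intro i j hij
    induction j, hij using Nat.le_induction with
    | base => simp
    | succ j _ ih =>
      rw [Finset.sum_range_succ]
      have := hH.dist_triangle (u := s i) (v := s j) (w := s (j + 1))
      omega
  refine ⟨fun v => ∑ k ∈ Finset.range (rk v), H.dist (s k) (s (k + 1)), fun v => ?_,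
    fun u v huv => ?_⟩
  · have := hrk v
    exact (hmono _ _ (by omega)).trans htour
  · dsimp only at huv ⊢
    rcases le_total (rk u) (rk v) with h | h
    · have := hdist _ _ h
      rw [hrks, hrks] at this
      omega
    · have h1 := hdist _ _ h
      have h2 := hmono _ _ h
      rw [hrks, hrks, SimpleGraph.dist_comm] at h1
      omega

/-- The number of vertices `s` whose information is stored at a vertex, `d` being the distance from
it: since `2 * pos s - d s` is strictly increasing in `pos s`, it meets the residue class of `0`
modulo `t` rarely. -/
theorem card_residue_le {V : Type*} [Fintype V] [DecidableEq V] (pos d : V → ℕ) {n t : ℕ}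
    (hpos : ∀ v, pos v ≤ 2 * n) (hd : ∀ v, d v ≤ n)
    (h : ∀ u v, u ≠ v → pos u ≤ pos v → pos u < pos v ∧ d v ≤ d u + (pos v - pos u)) :
    (Finset.univ.filter fun s => d s ≡ 2 * pos s [MOD t]).card ≤ 5 * n / t + 1 := by
  rw [← Finset.card_range (5 * n / t + 1)]
  have hmod : ∀ s, d s ≡ 2 * pos s [MOD t] → (2 * pos s + n - d s) % t = n % t := by
    intro s hs
    have h1 : 2 * pos s + n - d s + d s ≡ n + d s [MOD t] := by
      rw [Nat.sub_add_cancel (by have := hd s; omega), add_comm n]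
      exact Nat.ModEq.add_right n hs.symm
    exact Nat.ModEq.add_right_cancel' _ h1
  refine Finset.card_le_card_of_injOn (fun s => (2 * pos s + n - d s) / t) (fun s _ => ?_) ?_
  · have := hpos s
    simp only [Finset.coe_range, Set.mem_Iio]
    exact Nat.lt_succ_of_le (Nat.div_le_div_right (by omega))
  · intro u hu v hv huv
    simp only [Finset.coe_filter, Finset.mem_univ, true_and, Set.mem_ofPred_eq] at hu hv huv
    have heq : 2 * pos u + n - d u = 2 * pos v + n - d v := by
      rw [← Nat.div_add_mod (2 * pos u + n - d u) t, ← Nat.div_add_mod (2 * pos v + n - d v) t,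
        huv, hmod u hu, hmod v hv]
    by_contra hne
    have := hd u
    have := hd v
    rcases le_total (pos u) (pos v) with hle | hle
    · have := h u v hne hle; omega
    · have := h v u (Ne.symm hne) hle; omega

/-! ### Many rounds with short certificates -/

namespace SpreadScheme

/-- The number that stores the distance `x` to the node with identity `i`, in the spanner for
`tag = 0` and in the network for `tag = 1`. -/
def code (tag i x : ℕ) : ℕ := Nat.pair tag (Nat.pair i x)

theorem code_inj {tag i x tag' i' x' : ℕ} :
    code tag i x = code tag' i' x' ↔ tag = tag' ∧ i = i' ∧ x = x' := by
  simp [code, Nat.pair_eq_pair]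

/-- What a node with identity `a` and certificate `s` knows: the stored distances, and the distance
`0` to itself. -/
def Knows (tag : ℕ) (s : List Bool) (a i x : ℕ) : Prop :=
  (i = a ∧ x = 0) ∨ code tag i x ∈ decodeList s

/-- The verifier checks the potentials that are estimated from the known distances. -/
noncomputable def verifier (t α β : ℕ) : Verifier (Finset ℕ) := fun W =>
  W.Check α β Set.univ W.center
    (estimate W.spannerGraph (fun b => Knows 0 (W.certOf b) b) t)
    (estimate W.netGraph (fun b => Knows 1 (W.certOf b) b) t)

variable {c n t : ℕ} {α β : ℕ} {I : LabeledNetwork (Finset ℕ) c n}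

theorem verifier_view_iff (ht : 1 ≤ t) {cert : Fin n → List Bool} {v : Fin n} :
    verifier t α β (I.view t cert v) ↔ NodeCheck α β I Set.univ I.id
      (estimate I.spanner (fun w => Knows 0 (cert w) (I.id w)) t)
      (estimate I.graph (fun w => Knows 1 (cert w) (I.id w)) t) v :=
  check_view_iff (K := Set.univ) (ι := I.id) ht
    (fun _ hu => estimate_view inf_le_right I.spannerGraph_view_adj
      (fun w hw => by rw [I.certOf_view hw]) hu)
    (fun _ hu => estimate_view le_rfl I.netGraph_view_adj
      (fun w hw => by rw [I.certOf_view hw]) hu)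

theorem sound (ht : 1 ≤ t) {cert : Fin n → List Bool} (h : Accepts (verifier t α β) t I cert) :
    IsSpanner α β I :=
  NodeCheck.isSpanner (fun v => (verifier_view_iff ht).1 (h v)) I.id_injective

/-- The numbers stored at a node: the distances `d s` to the nodes `s` with
`d s ≡ 2 * pos s` modulo `t`. -/
noncomputable def stored (t tag : ℕ) (id pos d : Fin n → ℕ) : List ℕ :=
  (Finset.univ.filter fun s => d s ≡ 2 * pos s [MOD t]).toList.map fun s => code tag (id s) (d s)

theorem mem_stored {tag tag' i x : ℕ} {id pos d : Fin n → ℕ} :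
    code tag i x ∈ stored t tag' id pos d ↔
      tag = tag' ∧ ∃ s, d s ≡ 2 * pos s [MOD t] ∧ i = id s ∧ x = d s := by
  simp only [stored, List.mem_map, Finset.mem_toList, Finset.mem_filter, Finset.mem_univ, true_and,
    code_inj]
  constructor
  · rintro ⟨s, hs, rfl, rfl, rfl⟩; exact ⟨rfl, s, hs, rfl, rfl⟩
  · rintro ⟨rfl, s, hs, rfl, rfl⟩; exact ⟨s, hs, rfl, rfl, rfl⟩

theorem size_code_le (hn : 2 ≤ n) (hc : 1 ≤ c) {tag i x : ℕ} (htag : tag ≤ 1) (hi : i ≤ n ^ c)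
    (hx : x ≤ n) : 2 * (code tag i x).size + 1 ≤ (8 * c + 11) * n.size := by
  have hnc : n ≤ n ^ c := Nat.le_self_pow (by omega) n
  have h1 : Nat.pair i x < (n ^ c + 1) ^ 2 := (Nat.pair_lt_max_add_one_sq i x).trans_le
    (Nat.pow_le_pow_left (by omega) 2)
  have h2 : code tag i x < ((n ^ c + 1) ^ 2) ^ 2 :=
    (Nat.pair_lt_max_add_one_sq _ _).trans_le (Nat.pow_le_pow_left (by
      have : 1 < (n ^ c + 1) ^ 2 := by nlinarith
      omega) 2)
  have h3 : ((n ^ c + 1) ^ 2) ^ 2 ≤ n ^ (4 * (c + 1)) := by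
    rw [← pow_mul, mul_comm 4, pow_mul n]
    refine Nat.pow_le_pow_left ?_ _
    rw [pow_succ]
    nlinarith
  have h4 := (Nat.size_le_size (h2.le.trans h3)).trans (Nat.size_pow_le n (4 * (c + 1)))
  have h5 : 1 ≤ n.size := Nat.size_pos.2 (by omega)
  nlinarith

theorem length_stored_le (hn : 2 ≤ n) (hc : 1 ≤ c) {tag : ℕ} (htag : tag ≤ 1)
    {id pos d : Fin n → ℕ} (hid : ∀ s, id s ≤ n ^ c) (hd : ∀ s, d s ≤ n)
    (hpos : ∀ v, pos v ≤ 2 * n)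
    (h : ∀ u v, u ≠ v → pos u ≤ pos v → pos u < pos v ∧ d v ≤ d u + (pos v - pos u)) :
    (encodeList (stored t tag id pos d)).length ≤
      (5 * n / t + 1) * ((8 * c + 11) * n.size) := by
  rw [length_encodeList]
  refine (List.sum_le_card_nsmul _ ((8 * c + 11) * n.size) fun x hx => ?_).trans ?_
  · simp only [stored, List.map_map, List.mem_map, Function.comp_apply] at hx
    obtain ⟨s, -, rfl⟩ := hx
    exact size_code_le hn hc htag (hid s) (hd s)
  · simp only [stored, List.length_map, Finset.length_toList, smul_eq_mul]
    gcongr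
    exact card_residue_le pos d hpos hd h

theorem complete (hc : 1 ≤ c) (ht : 1 ≤ t) (hα : 1 ≤ α) (hI : IsSpanner α β I) : ∃ cert,
    Accepts (verifier t α β) t I cert ∧ ∀ v, (cert v).length ≤
      if n ≤ t then 0 else 2 * ((5 * n / t + 1) * ((8 * c + 11) * n.size)) := by
  have hH := hI.spanner_connected
  obtain ⟨pos, hpos, hplace⟩ := hH.exists_line_placement
  rw [Fintype.card_fin] at hpos
  have hdle : ∀ u w, I.graph.dist u w ≤ I.spanner.dist u w := fun u w =>
    SimpleGraph.Reachable.dist_anti inf_le_right (hH.preconnected u w)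
  have hlt : ∀ v u w : Fin n, I.spanner.dist u w < n := fun v u w => by
    have := hH.dist_le_card u w
    have := v.2
    rw [Fintype.card_fin] at *
    omega
  let cert : Fin n → List Bool := fun v => if n ≤ t then encodeList [] else
    encodeList (stored t 0 I.id pos (I.spanner.dist v) ++ stored t 1 I.id pos (I.graph.dist v))
  -- what the nodes know
  have hknow : ∀ tag (G : SimpleGraph (Fin n)), tag = 0 ∧ G = I.spanner ∨ tag = 1 ∧ G = I.graph →
      ∀ w i x, Knows tag (cert w) (I.id w) i x ↔ (i = I.id w ∧ x = 0) ∨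
        t < n ∧ ∃ s, G.dist w s ≡ 2 * pos s [MOD t] ∧ i = I.id s ∧ x = G.dist w s := by
    intro tag G htag w i x
    refine or_congr Iff.rfl ?_
    by_cases hnt : n ≤ t
    · simp [cert, hnt]
    · simp only [cert, if_neg hnt, decodeList_encodeList, List.mem_append, mem_stored,
        not_le.1 hnt, true_and]
      rcases htag with ⟨rfl, rfl⟩ | ⟨rfl, rfl⟩ <;> simp
  have hdist : ∀ tag (G : SimpleGraph (Fin n)), tag = 0 ∧ G = I.spanner ∨ tag = 1 ∧ G = I.graph →
      ∀ u s, estimate G (fun w => Knows tag (cert w) (I.id w)) t u (I.id s) = G.edist u s := by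
    intro tag G htag u s
    have hG : G.Connected ∧ G.dist u s < n := by
      rcases htag with ⟨rfl, rfl⟩ | ⟨rfl, rfl⟩
      · exact ⟨hH, hlt s _ _⟩
      · exact ⟨I.connected, (hdle _ _).trans_lt (hlt s _ _)⟩
    refine estimate_eq_edist hG.1 (r := 2 * pos s) ht (fun w x hx => ?_) (Or.inl ⟨rfl, rfl⟩)
      (fun w hw hmod => ?_)
    · rcases (hknow tag G htag w _ x).1 hx with ⟨h1, rfl⟩ | ⟨-, s', -, h1, rfl⟩
      · rw [I.id_injective h1, SimpleGraph.dist_self]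
      · rw [I.id_injective h1]
    · exact (hknow tag G htag w _ _).2 (Or.inr ⟨by omega, s, hmod, rfl, rfl⟩)
  have htop : ∀ tag (G : SimpleGraph (Fin n)), tag = 0 ∧ G = I.spanner ∨ tag = 1 ∧ G = I.graph →
      ∀ u k, (∀ s, I.id s ≠ k) → estimate G (fun w => Knows tag (cert w) (I.id w)) t u k = ⊤ := by
    intro tag G htag u k hk
    refine estimate_eq_top fun w x hx => ?_
    rcases (hknow tag G htag w _ x).1 hx with ⟨h1, -⟩ | ⟨-, s', -, h1, -⟩
    · exact hk w h1.symm
    · exact hk s' h1.symm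
  refine ⟨cert, fun v => (verifier_view_iff ht).2 ?_, fun v => ?_⟩
  · exact hI.nodeCheck hα (fun _ => Set.mem_univ _) (hdist 0 _ (Or.inl ⟨rfl, rfl⟩))
      (hdist 1 _ (Or.inr ⟨rfl, rfl⟩)) (fun u k _ => htop 0 _ (Or.inl ⟨rfl, rfl⟩) u k)
      (fun u k _ => htop 1 _ (Or.inr ⟨rfl, rfl⟩) u k) v
  · by_cases hnt : n ≤ t
    · simp [cert, hnt, encodeList]
    · simp only [cert, if_neg hnt]
      have happ : ∀ l l' : List ℕ, (encodeList (l ++ l')).length =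
          (encodeList l).length + (encodeList l').length := fun l l' => by
        simp [encodeList]
      have hsep : ∀ u w, u ≠ w → pos u ≤ pos w → pos u < pos w := fun u w hne hle => by
        have := hplace u w hle
        have := hH.pos_dist_of_ne hne
        omega
      rw [happ, two_mul]
      refine add_le_add (length_stored_le (by omega) hc (by omega) I.id_le
        (fun s => (hlt v v s).le) hpos fun u w hne hle => ⟨hsep u w hne hle, ?_⟩)
        (length_stored_le (by omega) hc le_rfl I.id_le
        (fun s => ((hdle v s).trans_lt (hlt v v s)).le) hpos
        fun u w hne hle => ⟨hsep u w hne hle, ?_⟩)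
      · have := hH.dist_triangle (u := v) (v := u) (w := w)
        have := hplace u w hle
        omega
      · have := I.connected.dist_triangle (u := v) (v := u) (w := w)
        have := hplace u w hle
        have := hdle u w
        omega

end SpreadScheme

theorem Nat.size_le_four_mul_log {n : ℕ} (hn : 2 ≤ n) : (n.size : ℝ) ≤ 4 * Real.log n := by
  have h0 : 0 < n.size := Nat.size_pos.2 (by omega)
  have h1 : 2 ^ (n.size - 1) ≤ n := Nat.lt_size.1 (by omega)
  have h2 : ((n.size - 1 : ℕ) : ℝ) * Real.log 2 ≤ Real.log n := by
    rw [← Real.log_pow]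
    exact Real.log_le_log (by positivity) (by exact_mod_cast h1)
  have h3 : Real.log 2 ≤ Real.log n := Real.log_le_log (by norm_num) (by exact_mod_cast hn)
  have h4 := Real.log_two_gt_d9
  rw [Nat.cast_sub h0, Nat.cast_one] at h2
  have h5 : (n.size : ℝ) * (1 / 2) ≤ n.size * Real.log 2 := by gcongr; linarith
  linarith

/-- For `t` rounds, certificates of size `O((n / t) log n)` suffice. -/
theorem exists_spread_scheme {c : ℕ} (hc : 1 ≤ c) {α : ℕ} (hα : 1 ≤ α) (β : ℕ) {t : ℕ}
    (ht : 1 ≤ t) : ∃ (p : ∀ n, Prover (Finset ℕ) c n) (V : Verifier (Finset ℕ)),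
      (∀ n, IsPLS t (IsSpanner α β) (p n) V) ∧
      ∀ n : ℕ, 2 ≤ n → (certSize (IsSpanner α β) (p n) : ℝ≥0∞) ≤
        ENNReal.ofReal (48 * (8 * c + 11) * Real.log n ^ 1 * (n / t)) := by
  obtain ⟨p, h1, h2⟩ := exists_prover (P := fun n => IsSpanner α β (c := c) (n := n))
    (V := SpreadScheme.verifier t α β)
    (B := fun n => if n ≤ t then 0 else 2 * ((5 * n / t + 1) * ((8 * c + 11) * n.size)))
    (fun n I hI => SpreadScheme.complete hc ht hα hI) (fun n I cert h => SpreadScheme.sound ht h)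
  refine ⟨p, _, h1, fun n hn => (ENat.toENNReal_le.2 (h2 n)).trans ?_⟩
  rw [ENat.toENNReal_coe, ← ENNReal.ofReal_natCast]
  refine ENNReal.ofReal_le_ofReal ?_
  have hlog : 0 ≤ Real.log n := Real.log_nonneg (by exact_mod_cast (by omega : 1 ≤ n))
  split_ifs with hnt
  · rw [Nat.cast_zero]; positivity
  · have ht0 : (0 : ℝ) < t := by exact_mod_cast ht
    have h3 : ((5 * n / t : ℕ) : ℝ) ≤ 5 * n / t := by
      refine Nat.cast_div_le.trans ?_
      push_cast; rfl
    have h4 : (1 : ℝ) ≤ n / t := by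
      rw [one_le_div ht0]; exact_mod_cast (by omega : t ≤ n)
    have h5 : ((5 * n / t : ℕ) : ℝ) + 1 ≤ 6 * (n / t) := by
      rw [mul_div_assoc] at h3; linarith
    push_cast
    calc 2 * ((((5 * n / t : ℕ) : ℝ) + 1) * ((8 * c + 11) * (n.size : ℝ)))
        ≤ 2 * ((6 * (n / t)) * ((8 * c + 11) * (4 * Real.log n))) := by
          gcongr; exact Nat.size_le_four_mul_log hn
      _ = 48 * (8 * c + 11) * Real.log n ^ 1 * (n / t) := by ring

/-! ### Additive spanners and stars -/

theorem SimpleGraph.Connected.le_add_dist {V : Type*} {G : SimpleGraph V} (hG : G.Connected)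
    {φ : V → ℕ} (hφ : ∀ x y, G.Adj x y → φ y ≤ φ x + 1) (x y : V) : φ y ≤ φ x + G.dist x y := by
  obtain ⟨p, hp⟩ := hG.exists_walk_length_eq_dist x y
  rw [← hp]
  clear hp
  induction p with
  | nil => simp
  | cons h p ih =>
    have := hφ _ _ h
    rw [SimpleGraph.Walk.length_cons]
    omega

section Star

variable {V ι : Type*} {G H : SimpleGraph V} {a₀ b₀ : V} {u v : ι → V} {a b : ι → Prop} {M β : ℕ}

/-- `G` consists of `H`, a star with centre `a₀` whose leaves are the `u i` with `a i`, and a star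
with centre `b₀` whose leaves are the `v i` with `b i`. -/
def IsStarExtension (G H : SimpleGraph V) (a₀ b₀ : V) (u v : ι → V) (a b : ι → Prop) : Prop :=
  ∀ x y, G.Adj x y → H.Adj x y ∨ (x = a₀ ∧ ∃ i, a i ∧ y = u i) ∨ (y = a₀ ∧ ∃ i, a i ∧ x = u i) ∨
    (x = b₀ ∧ ∃ i, b i ∧ y = v i) ∨ (y = b₀ ∧ ∃ i, b i ∧ x = v i)

/-- How far one gets from the centre `a₀`: a walk from `a₀` is at least as long as a walk in `H`, or
as one that first uses an edge of the star at `a₀`, or as one that first goes to `b₀` and uses an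
edge of the star there. -/
theorem IsStarExtension.dist_center (hG : IsStarExtension G H a₀ b₀ u v a b) (hH : H.Connected)
    (hHG : H ≤ G) (h5 : H.dist a₀ b₀ = M) (h6 : ∀ i, M ≤ H.dist (u i) b₀ + 1)
    (h7 : ∀ j, M ≤ H.dist a₀ (v j) + 1) (h8 : ∀ i j, M ≤ H.dist (u i) (v j) + 2) (x : V) :
    H.dist a₀ x ≤ G.dist x a₀ ∨ (∃ i, a i ∧ 1 + H.dist (u i) x ≤ G.dist x a₀) ∨
      ∃ j, b j ∧ M + 1 + H.dist (v j) x ≤ G.dist x a₀ := by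
  obtain ⟨p, hp⟩ := (hH.mono hHG).exists_walk_length_eq_dist x a₀
  rw [← hp]
  clear hp
  generalize hz : a₀ = z at p
  induction p with
  | nil => subst hz; left; simp
  | @cons x y z hxy p ih =>
    subst hz
    have ih := ih rfl
    rw [SimpleGraph.Walk.length_cons]
    rcases hG x y hxy with h | ⟨rfl, -⟩ | ⟨-, i, hi, rfl⟩ | ⟨rfl, j, hj, rfl⟩ | ⟨rfl, j, hj, rfl⟩
    · have hd : ∀ w, H.dist w x ≤ H.dist w y + 1 := fun w => by
        have := hH.dist_triangle (u := w) (v := y) (w := x)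
        rwa [SimpleGraph.dist_eq_one_iff_adj.2 h.symm] at this
      rcases ih with h1 | ⟨i, hi, h1⟩ | ⟨j, hj, h1⟩
      · have := hd a₀; left; omega
      · have := hd (u i); right; left; exact ⟨i, hi, by omega⟩
      · have := hd (v j); right; right; exact ⟨j, hj, by omega⟩
    · left; simp
    · right; left; exact ⟨i, hi, by simp⟩
    · left
      have := h7 j
      rcases ih with h1 | ⟨i, hi, h1⟩ | ⟨j', hj', h1⟩
      · omega
      · have := h8 i j; omega
      · omega
    · right; right
      refine ⟨j, hj, ?_⟩
      rw [SimpleGraph.dist_self]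
      rcases ih with h1 | ⟨i, hi, h1⟩ | ⟨j', hj', h1⟩
      · omega
      · have := h6 i; omega
      · omega

/-- A detour through the centre `a₀` is at most `β` shorter than the way in `H`. -/
theorem IsStarExtension.dist_le_through_center (hG : IsStarExtension G H a₀ b₀ u v a b)
    (hH : H.Connected) (hHG : H ≤ G) (h1 : ∀ i, H.dist a₀ (u i) ≤ β + 1)
    (h2 : ∀ i j, H.dist (u i) (u j) ≤ 2) (h2' : ∀ i j, H.dist (v i) (v j) ≤ 2)
    (h3 : ∀ j, H.dist a₀ (v j) ≤ M + β + 1)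
    (h4 : ∀ i j, a i → b j → H.dist (u i) (v j) ≤ M + 2 + β)
    (h5 : H.dist a₀ b₀ = M) (h6 : ∀ i, M ≤ H.dist (u i) b₀ + 1)
    (h7 : ∀ j, M ≤ H.dist a₀ (v j) + 1) (h8 : ∀ i j, M ≤ H.dist (u i) (v j) + 2) (x y : V) :
    H.dist x y ≤ G.dist x a₀ + G.dist y a₀ + β := by
  -- the way from `x` to `y` through the two vertices where the ways from the centre enter `H`
  have hway : ∀ z w, H.dist x y ≤ H.dist z x + H.dist z w + H.dist w y := fun z w => by
    have := hH.dist_triangle (u := x) (v := z) (w := y)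
    have := hH.dist_triangle (u := z) (v := w) (w := y)
    rw [SimpleGraph.dist_comm (u := x) (v := z)] at *
    omega
  have hself : ∀ z, H.dist z z = 0 := fun z => SimpleGraph.dist_self
  have hcomm : ∀ z w, H.dist z w = H.dist w z := fun z w => SimpleGraph.dist_comm
  rcases hG.dist_center hH hHG h5 h6 h7 h8 x with hx | ⟨i, hi, hx⟩ | ⟨i, hi, hx⟩ <;>
  rcases hG.dist_center hH hHG h5 h6 h7 h8 y with hy | ⟨j, hj, hy⟩ | ⟨j, hj, hy⟩
  · have := hway a₀ a₀; have := hself a₀; omega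
  · have := hway a₀ (u j); have := h1 j; omega
  · have := hway a₀ (v j); have := h3 j; omega
  · have := hway (u i) a₀; have := h1 i; have := hcomm (u i) a₀; omega
  · have := hway (u i) (u j); have := h2 i j; omega
  · have := hway (u i) (v j); have := h4 i j hi hj; omega
  · have := hway (v i) a₀; have := h3 i; have := hcomm (v i) a₀; omega
  · have := hway (v i) (u j); have := h4 j i hj hi; have := hcomm (v i) (u j); omega
  · have := hway (v i) (v j); have := h2' i j; omega

/-- If all detours through the centres of the stars save at most `β`, then `H` is a `β`-additive
spanner of `G`. -/
theorem IsStarExtension.dist_le (hG : IsStarExtension G H a₀ b₀ u v a b)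
    (hH : H.Connected) (hHG : H ≤ G)
    (ha : ∀ x y, H.dist x y ≤ G.dist x a₀ + G.dist y a₀ + β)
    (hb : ∀ x y, H.dist x y ≤ G.dist x b₀ + G.dist y b₀ + β) (x y : V) :
    H.dist x y ≤ G.dist x y + β := by
  have hGc := hH.mono hHG
  obtain ⟨p, hp⟩ := hGc.exists_walk_length_eq_dist x y
  have key : ∀ {x y} (p : G.Walk x y), H.dist x y ≤ p.length ∨
      ∃ z, (z = a₀ ∨ z = b₀) ∧ G.dist x z + G.dist z y ≤ p.length := by
    intro x y p
    induction p with
    | nil => left; simp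
    | @cons x x' y hadj p ih =>
      rw [SimpleGraph.Walk.length_cons]
      have hle := SimpleGraph.dist_le p
      have h1 := SimpleGraph.dist_eq_one_iff_adj.2 hadj
      have hend : ∀ z, z = a₀ ∨ z = b₀ → z = x ∨ z = x' →
          ∃ z, (z = a₀ ∨ z = b₀) ∧ G.dist x z + G.dist z y ≤ p.length + 1 := by
        rintro z hz (rfl | rfl)
        · refine ⟨z, hz, ?_⟩
          have := hGc.dist_triangle (u := z) (v := x') (w := y)
          rw [SimpleGraph.dist_self]
          omega
        · exact ⟨z, hz, by omega⟩
      rcases hG x x' hadj with h | ⟨h, -⟩ | ⟨h, -⟩ | ⟨h, -⟩ | ⟨h, -⟩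
      · rcases ih with ih | ⟨z, hz, ih⟩
        · left
          have := hH.dist_triangle (u := x) (v := x') (w := y)
          rw [SimpleGraph.dist_eq_one_iff_adj.2 h] at this
          omega
        · right
          have := hGc.dist_triangle (u := x) (v := x') (w := z)
          exact ⟨z, hz, by omega⟩
      · exact Or.inr (hend _ (Or.inl h) (Or.inl rfl))
      · exact Or.inr (hend _ (Or.inl h) (Or.inr rfl))
      · exact Or.inr (hend _ (Or.inr h) (Or.inl rfl))
      · exact Or.inr (hend _ (Or.inr h) (Or.inr rfl))
  rcases key p with h | ⟨z, rfl | rfl, h⟩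
  · omega
  · have := ha x y; rw [SimpleGraph.dist_comm (u := y)] at this; omega
  · have := hb x y; rw [SimpleGraph.dist_comm (u := y)] at this; omega

theorem IsStarExtension.symm (hG : IsStarExtension G H a₀ b₀ u v a b) :
    IsStarExtension G H b₀ a₀ v u b a := fun x y h => by
  rcases hG x y h with h | h | h | h | h
  · exact .inl h
  · exact .inr (.inr (.inr (.inl h)))
  · exact .inr (.inr (.inr (.inr h)))
  · exact .inr (.inl h)
  · exact .inr (.inr (.inl h))

end Star

/-! ### The hard instances -/

/-- The vertices of the hard instances: `left i` and `right i` for every bit vector `i` of length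
`b`, for every coordinate `c` and bit `x` a path of length `L`, a further path of length `L + β`
(the hub path), and `m` pendant vertices. -/
inductive HardVertex (b L β m : ℕ)
  | left (i : Fin b → Bool)
  | right (i : Fin b → Bool)
  | bit (c : Fin b) (x : Bool) (s : Fin (L + 1))
  | hub (s : Fin (L + β + 1))
  | pad (w : Fin m)

namespace HardVertex

variable {b L β m : ℕ}

/-- The hard vertices as a sum type. -/
def equivSum : HardVertex b L β m ≃ ((Fin b → Bool) ⊕ (Fin b → Bool)) ⊕
    (Fin b × Bool × Fin (L + 1)) ⊕ Fin (L + β + 1) ⊕ Fin m where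
  toFun
    | left i => .inl (.inl i)
    | right i => .inl (.inr i)
    | bit c x s => .inr (.inl (c, x, s))
    | hub s => .inr (.inr (.inl s))
    | pad w => .inr (.inr (.inr w))
  invFun
    | .inl (.inl i) => left i
    | .inl (.inr i) => right i
    | .inr (.inl (c, x, s)) => bit c x s
    | .inr (.inr (.inl s)) => hub s
    | .inr (.inr (.inr w)) => pad w
  left_inv x := by cases x <;> rfl
  right_inv x := by rcases x with (_ | _) | _ | _ | _ <;> rfl

noncomputable instance : Fintype (HardVertex b L β m) := Fintype.ofEquiv _ equivSum.symm

theorem card : Fintype.card (HardVertex b L β m) =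
    2 * 2 ^ b + 2 * b * (L + 1) + (L + β + 1) + m := by
  rw [Fintype.card_congr equivSum]
  simp
  ring

/-- The marked edges. The bit path of `(c, x)` joins the vertices `left i` with `i c = x` to the
vertices `right j` with `j c ≠ x`; the hub path joins all `left i` to all `right j`. -/
def MarkedRel : HardVertex b L β m → HardVertex b L β m → Prop
  | left i, bit c x s => x = i c ∧ s.val = 0
  | left _, hub s => s.val = 0
  | right j, bit c x s => x ≠ j c ∧ s.val = L
  | right _, hub s => s.val = L + β
  | bit c x s, bit c' x' s' => c = c' ∧ x = x' ∧ s.val + 1 = s'.val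
  | hub s, hub s' => s.val + 1 = s'.val
  | pad _, hub s => s.val = 0
  | _, _ => False

/-- The unmarked edges: shortcuts from `left i` with `A i` and from `right j` with `B j` to the two
vertices at distance `β` from the ends of the hub path. -/
def ShortcutRel (A B : (Fin b → Bool) → Prop) : HardVertex b L β m → HardVertex b L β m → Prop
  | left i, hub s => A i ∧ s.val = β
  | right j, hub s => B j ∧ s.val = L
  | _, _ => False

/-- The spanner of the hard instances. -/
def spannerGraph (b L β m : ℕ) : SimpleGraph (HardVertex b L β m) :=
  SimpleGraph.fromRel MarkedRel

/-- The hard instance for two sets of bit vectors. -/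
def network (m : ℕ) (A B : (Fin b → Bool) → Prop) : SimpleGraph (HardVertex b L β m) :=
  spannerGraph b L β m ⊔ SimpleGraph.fromRel (ShortcutRel A B)

theorem ne_of_rel {A B : (Fin b → Bool) → Prop} {x y : HardVertex b L β m}
    (h : MarkedRel x y ∨ ShortcutRel A B x y) : x ≠ y := by
  rintro rfl
  cases x <;> simp [MarkedRel, ShortcutRel] at h

theorem spannerGraph_adj_of_rel {x y : HardVertex b L β m} (h : MarkedRel x y) :
    (spannerGraph b L β m).Adj x y :=
  (SimpleGraph.fromRel_adj _ _ _).2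
    ⟨ne_of_rel (A := fun _ => True) (B := fun _ => True) (Or.inl h), Or.inl h⟩

theorem network_adj_of_rel {A B : (Fin b → Bool) → Prop} {x y : HardVertex b L β m}
    (h : ShortcutRel A B x y) : (network m A B).Adj x y :=
  Or.inr ((SimpleGraph.fromRel_adj _ _ _).2 ⟨ne_of_rel (Or.inr h), Or.inl h⟩)

theorem spannerGraph_le_network (A B : (Fin b → Bool) → Prop) :
    spannerGraph b L β m ≤ network m A B := le_sup_left

theorem lipschitz_of_rel {φ : HardVertex b L β m → ℕ}
    (h : ∀ x y, MarkedRel x y → φ y ≤ φ x + 1 ∧ φ x ≤ φ y + 1) (x y : HardVertex b L β m)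
    (hxy : (spannerGraph b L β m).Adj x y) : φ y ≤ φ x + 1 := by
  rcases (SimpleGraph.fromRel_adj _ _ _).1 hxy with ⟨-, h' | h'⟩
  · exact (h x y h').1
  · exact (h y x h').2

theorem exists_walk_hub (k : ℕ) : ∀ s s' : Fin (L + β + 1), s.val + k = s'.val →
    ∃ p : (spannerGraph b L β m).Walk (hub s) (hub s'), p.length = k := by
  induction k with
  | zero =>
    intro s s' h
    obtain rfl : s = s' := Fin.ext h
    exact ⟨.nil, rfl⟩
  | succ k ih =>
    intro s s' h
    have := s'.2
    obtain ⟨p, hp⟩ := ih ⟨s.val + 1, by omega⟩ s' (by simp only; omega)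
    exact ⟨.cons (spannerGraph_adj_of_rel (x := hub s) (y := hub ⟨s.val + 1, by omega⟩) rfl) p,
      by rw [SimpleGraph.Walk.length_cons, hp]⟩

theorem exists_walk_bit (c : Fin b) (x : Bool) (k : ℕ) : ∀ s s' : Fin (L + 1), s.val + k = s'.val →
    ∃ p : (spannerGraph b L β m).Walk (bit c x s) (bit c x s'), p.length = k := by
  induction k with
  | zero =>
    intro s s' h
    obtain rfl : s = s' := Fin.ext h
    exact ⟨.nil, rfl⟩
  | succ k ih =>
    intro s s' h
    have := s'.2
    obtain ⟨p, hp⟩ := ih ⟨s.val + 1, by omega⟩ s' (by simp only; omega)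
    exact ⟨.cons (spannerGraph_adj_of_rel (x := bit c x s) (y := bit c x ⟨s.val + 1, by omega⟩)
      ⟨rfl, rfl, rfl⟩) p, by rw [SimpleGraph.Walk.length_cons, hp]⟩

theorem spannerGraph_connected : (spannerGraph b L β m).Connected := by
  have hhub : ∀ s, (spannerGraph b L β m).Reachable (hub 0) (hub s) := fun s =>
    ⟨(exists_walk_hub s.val 0 s (by simp)).choose⟩
  have hleft : ∀ i, (spannerGraph b L β m).Reachable (hub 0) (left i) := fun i =>
    (spannerGraph_adj_of_rel (x := left i) (y := hub 0) rfl).symm.reachable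
  have h : ∀ x, (spannerGraph b L β m).Reachable (hub 0) x := by
    rintro (i | j | ⟨c, x, s⟩ | s | w)
    · exact hleft i
    · exact (hhub (Fin.last _)).trans
        (spannerGraph_adj_of_rel (x := right j) (y := hub (Fin.last _)) rfl).symm.reachable
    · exact ((hleft fun _ => x).trans (spannerGraph_adj_of_rel (x := left fun _ => x)
        (y := bit c x 0) ⟨rfl, rfl⟩).reachable).trans
          ⟨(exists_walk_bit c x s.val 0 s (by simp)).choose⟩
    · exact hhub s
    · exact (spannerGraph_adj_of_rel (x := pad w) (y := hub 0) rfl).symm.reachable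
  have : Nonempty (HardVertex b L β m) := ⟨hub 0⟩
  exact ⟨fun x y => (h x).symm.trans (h y)⟩

theorem network_connected (A B : (Fin b → Bool) → Prop) :
    (network (L := L) (β := β) m A B).Connected :=
  spannerGraph_connected.mono (spannerGraph_le_network A B)

/-- The centre of the left star. -/
def leftHub (hL : β ≤ L) : HardVertex b L β m := hub ⟨β, by omega⟩

/-- The centre of the right star. -/
def rightHub : HardVertex b L β m := hub ⟨L, by omega⟩

theorem isStarExtension (hL : β ≤ L) (A B : (Fin b → Bool) → Prop) :
    IsStarExtension (network m A B) (spannerGraph b L β m) (leftHub hL) rightHub left right A B := by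
  have key : ∀ x y : HardVertex b L β m, ShortcutRel A B x y →
      (y = leftHub hL ∧ ∃ i, A i ∧ x = left i) ∨ (y = rightHub ∧ ∃ i, B i ∧ x = right i) := by
    rintro (i | j | ⟨c, x, s⟩ | s | w) (i' | j' | ⟨c', x', s'⟩ | s' | w') h <;>
      simp only [ShortcutRel] at h
    · exact Or.inl ⟨by rw [leftHub]; congr; exact Fin.ext h.2, i, h.1, rfl⟩
    · exact Or.inr ⟨by rw [rightHub]; congr; exact Fin.ext h.2, j, h.1, rfl⟩
  intro x y hxy
  rcases hxy with h | h
  · exact Or.inl h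
  · rcases (SimpleGraph.fromRel_adj _ _ _).1 h with ⟨-, h | h⟩
    · rcases key x y h with h | h
      · exact .inr (.inr (.inl h))
      · exact .inr (.inr (.inr (.inr h)))
    · rcases key y x h with h | h
      · exact .inr (.inl h)
      · exact .inr (.inr (.inr (.inl h)))

theorem dist_hub_le (s s' : Fin (L + β + 1)) (h : s.val ≤ s'.val) :
    (spannerGraph b L β m).dist (hub s) (hub s') ≤ s'.val - s.val := by
  obtain ⟨p, hp⟩ := exists_walk_hub (b := b) (m := m) (s'.val - s.val) s s' (by omega)
  exact hp ▸ SimpleGraph.dist_le p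

theorem dist_left_hub (i : Fin b → Bool) :
    (spannerGraph b L β m).dist (left i) (hub 0) = 1 :=
  SimpleGraph.dist_eq_one_iff_adj.2 (spannerGraph_adj_of_rel (x := left i) (y := hub 0) rfl)

theorem dist_right_hub (i : Fin b → Bool) :
    (spannerGraph b L β m).dist (right i) (hub (Fin.last _)) = 1 :=
  SimpleGraph.dist_eq_one_iff_adj.2
    (spannerGraph_adj_of_rel (x := right i) (y := hub (Fin.last _)) rfl)

/-- Vertices of different vectors are joined by a bit path. -/
theorem dist_left_right_le {i j : Fin b → Bool} (hij : i ≠ j) :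
    (spannerGraph b L β m).dist (left i) (right j) ≤ L + 2 := by
  obtain ⟨c, hc⟩ := Function.ne_iff.1 hij
  obtain ⟨p, hp⟩ := exists_walk_bit (b := b) (β := β) (m := m) c (i c) L 0 (Fin.last L) (by simp)
  have h1 := spannerGraph_adj_of_rel (L := L) (β := β) (m := m) (x := left i)
    (y := bit c (i c) 0) ⟨rfl, rfl⟩
  have h2 := spannerGraph_adj_of_rel (L := L) (β := β) (m := m) (x := right j)
    (y := bit c (i c) (Fin.last L)) ⟨hc, rfl⟩
  have := SimpleGraph.dist_le ((SimpleGraph.Walk.cons h1 p).concat h2.symm)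
  simpa [hp] using this

/-- The position of a vertex between the two sides. -/
def coord : HardVertex b L β m → ℕ
  | left _ => 0
  | right _ => L
  | bit _ _ s => s.val
  | hub s => min s.val L
  | pad _ => 0

theorem coord_le_add_dist (x y : HardVertex b L β m) :
    coord y ≤ coord x + (spannerGraph b L β m).dist x y := by
  refine spannerGraph_connected.le_add_dist (lipschitz_of_rel ?_) x y
  rintro (i | j | ⟨c, x, s⟩ | s | w) (i' | j' | ⟨c', x', s'⟩ | s' | w') h <;>
    simp only [MarkedRel] at h <;> simp only [coord] <;> omega

/-- Without a common vector, the marked edges form an additive spanner. -/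
theorem dist_le_of_disjoint (hL : β ≤ L) {A B : (Fin b → Bool) → Prop}
    (hAB : ∀ i, A i → ¬ B i) (x y : HardVertex b L β m) :
    (spannerGraph b L β m).dist x y ≤ (network m A B).dist x y + β := by
  have hH := spannerGraph_connected (b := b) (L := L) (β := β) (m := m)
  have hcomm : ∀ x y, (spannerGraph b L β m).dist x y = (spannerGraph b L β m).dist y x :=
    fun x y => SimpleGraph.dist_comm
  have htri : ∀ x y z, (spannerGraph b L β m).dist x z ≤
      (spannerGraph b L β m).dist x y + (spannerGraph b L β m).dist y z :=
    fun x y z => hH.dist_triangle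
  have hll : ∀ i j, (spannerGraph b L β m).dist (left i) (left j) ≤ 2 := fun i j => by
    have := htri (left i) (hub 0) (left j)
    have := hcomm (hub 0) (left j)
    have := dist_left_hub (L := L) (β := β) (m := m) i
    have := dist_left_hub (L := L) (β := β) (m := m) j
    omega
  have hrr : ∀ i j, (spannerGraph b L β m).dist (right i) (right j) ≤ 2 := fun i j => by
    have := htri (right i) (hub (Fin.last _)) (right j)
    have := hcomm (hub (Fin.last _)) (right j)
    have := dist_right_hub (L := L) (β := β) (m := m) i
    have := dist_right_hub (L := L) (β := β) (m := m) j
    omega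
  have hl : ∀ (s : Fin (L + β + 1)) i, (spannerGraph b L β m).dist (hub s) (left i) ≤ s.val + 1 :=
    fun s i => by
      have := htri (hub s) (hub 0) (left i)
      have := hcomm (hub 0) (left i)
      have := hcomm (hub 0) (hub s)
      have := dist_hub_le (b := b) (m := m) 0 s (by simp)
      have := dist_left_hub (L := L) (β := β) (m := m) i
      simp only [Fin.val_zero] at *
      omega
  have hr : ∀ (s : Fin (L + β + 1)) j,
      (spannerGraph b L β m).dist (hub s) (right j) ≤ L + β - s.val + 1 := fun s j => by
    have := s.2
    have := htri (hub s) (hub (Fin.last _)) (right j)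
    have := hcomm (hub (Fin.last _)) (right j)
    have := dist_hub_le (b := b) (m := m) s (Fin.last _) (by simp only [Fin.val_last]; omega)
    have := dist_right_hub (L := L) (β := β) (m := m) j
    simp only [Fin.val_last] at *
    omega
  have hhubs : (spannerGraph b L β m).dist (leftHub hL) rightHub = L - β := by
    refine le_antisymm (dist_hub_le _ _ hL) ?_
    have := coord_le_add_dist (b := b) (m := m) (leftHub hL) rightHub
    simp only [coord, leftHub, rightHub] at this ⊢
    omega
  have hlr : ∀ i j, A i → B j →
      (spannerGraph b L β m).dist (left i) (right j) ≤ L - β + 2 + β := fun i j hi hj => by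
    have := dist_left_right_le (L := L) (β := β) (m := m)
      (show i ≠ j by rintro rfl; exact hAB i hi hj)
    omega
  have hcl : ∀ i, L ≤ (spannerGraph b L β m).dist (left i) rightHub := fun i => by
    have := coord_le_add_dist (L := L) (β := β) (m := m) (left i) rightHub
    simp only [coord, rightHub] at this ⊢
    omega
  have hcr : ∀ j, L ≤ (spannerGraph b L β m).dist (leftHub hL) (right j) + β := fun j => by
    have := coord_le_add_dist (L := L) (β := β) (m := m) (leftHub hL) (right j)
    simp only [coord, leftHub] at this ⊢
    omega
  have hclr : ∀ i j, L ≤ (spannerGraph b L β m).dist (left i) (right j) := fun i j => by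
    have := coord_le_add_dist (L := L) (β := β) (m := m) (left i) (right j)
    simp only [coord] at this
    omega
  have hle := spannerGraph_le_network (L := L) (β := β) (m := m) A B
  have hstar := isStarExtension (m := m) hL A B
  refine hstar.dist_le hH hle ?_ ?_ x y
  · refine hstar.dist_le_through_center (M := L - β) hH hle (fun i => hl _ i) hll hrr
      (fun j => ?_) hlr hhubs (fun i => ?_) (fun j => ?_) (fun i j => ?_)
    · have := hr ⟨β, by omega⟩ j
      simp only [leftHub] at *
      omega
    · have := hcl i; omega
    · have := hcr j; omega
    · have := hclr i j; omega
  · refine hstar.symm.dist_le_through_center (M := L - β) hH hle (fun i => ?_) hrr hll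
      (fun j => ?_) (fun i j hi hj => ?_) ((hcomm _ _).trans hhubs) (fun i => ?_) (fun j => ?_)
      (fun i j => ?_)
    · have := hr ⟨L, by omega⟩ i
      simp only [rightHub] at *
      omega
    · have := hl ⟨L, by omega⟩ j
      simp only [rightHub] at *
      omega
    · rw [hcomm]; exact hlr j i hj hi
    · have := hcr i; rw [hcomm]; omega
    · have := hcl j; rw [hcomm]; omega
    · have := hclr j i; rw [hcomm]; omega

open Classical in
/-- A lower bound for the distances from `left i` in the spanner. -/
noncomputable def coordFrom (i : Fin b → Bool) : HardVertex b L β m → ℕ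
  | left j => if j = i then 0 else 2
  | right j => if j = i then L + 3 else L + 2
  | bit c x s => if x = i c then s.val + 1 else s.val + 3
  | hub s => min (s.val + 1) (L + 3)
  | pad _ => 1

theorem coordFrom_le_add_dist (hβ : 1 ≤ β) (i : Fin b → Bool) (x y : HardVertex b L β m) :
    coordFrom i y ≤ coordFrom i x + (spannerGraph b L β m).dist x y := by
  refine spannerGraph_connected.le_add_dist (lipschitz_of_rel ?_) x y
  rintro (j | j | ⟨c, x, s⟩ | s | w) (j' | j' | ⟨c', x', s'⟩ | s' | w') h <;>
    simp only [MarkedRel] at h <;> simp only [coordFrom]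
  · by_cases hj : j = i
    · subst hj; rw [if_pos h.1, if_pos rfl]; omega
    · rw [if_neg hj]; split_ifs <;> omega
  · split_ifs <;> omega
  · by_cases hj : j = i
    · subst hj; rw [if_neg h.1, if_pos rfl]; omega
    · rw [if_neg hj]; split_ifs <;> omega
  · split_ifs <;> omega
  · obtain ⟨rfl, rfl, h⟩ := h
    split_ifs <;> omega
  · omega
  · omega

/-- With a common vector, the marked edges do not form an additive spanner. -/
theorem lt_dist_of_common (hβ : 1 ≤ β) (hL : β ≤ L) {A B : (Fin b → Bool) → Prop}
    {i : Fin b → Bool} (hA : A i) (hB : B i) :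
    (network (L := L) (β := β) m A B).dist (left i) (right i) + β <
      (spannerGraph b L β m).dist (left i) (right i) := by
  have h1 := coordFrom_le_add_dist (L := L) (m := m) hβ i (left i) (right i)
  simp only [coordFrom, if_true] at h1
  have hG := network_connected (L := L) (β := β) (m := m) A B
  have h2 : (network m A B).Adj (left i) (leftHub hL) := network_adj_of_rel ⟨hA, rfl⟩
  have h3 : (network (L := L) (β := β) m A B).Adj (right i) rightHub :=
    network_adj_of_rel ⟨hB, rfl⟩
  have h4 : (network m A B).dist (leftHub hL) rightHub ≤ L - β :=
    (SimpleGraph.Reachable.dist_anti (spannerGraph_le_network A B)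
      (spannerGraph_connected.preconnected _ _)).trans
      (dist_hub_le (b := b) (m := m) ⟨β, by omega⟩ ⟨L, by omega⟩ hL)
  have h5 := hG.dist_triangle (u := left i) (v := leftHub hL) (w := right i)
  have h6 := hG.dist_triangle (u := leftHub hL) (v := rightHub) (w := right i)
  rw [SimpleGraph.dist_eq_one_iff_adj.2 h2] at h5
  rw [SimpleGraph.dist_eq_one_iff_adj.2 h3.symm] at h6
  omega

/-- The position of a vertex, without the parts of the hub path behind the centres of the stars. -/
def level : HardVertex b L β m → ℕ := fun x => max β (coord x)

theorem level_le_of_adj (hL : β ≤ L) {A B : (Fin b → Bool) → Prop} {x y : HardVertex b L β m}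
    (h : (network m A B).Adj x y) : level y ≤ level x + 1 := by
  have key : ∀ x y : HardVertex b L β m, MarkedRel x y ∨ ShortcutRel A B x y →
      level y ≤ level x + 1 ∧ level x ≤ level y + 1 := by
    rintro (i | j | ⟨c, x, s⟩ | s | w) (i' | j' | ⟨c', x', s'⟩ | s' | w') h <;>
      simp only [MarkedRel, ShortcutRel, or_false] at h <;>
      simp only [level, coord] <;> omega
  rcases h with h | h <;> rcases (SimpleGraph.fromRel_adj _ _ _).1 h with ⟨-, h | h⟩
  · exact (key x y (Or.inl h)).1
  · exact (key y x (Or.inl h)).2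
  · exact (key x y (Or.inr h)).1
  · exact (key y x (Or.inr h)).2

/-- Below the level of the right star, the network does not depend on `B`. -/
theorem network_adj_congr_right (hL : β ≤ L) {A B B' : (Fin b → Bool) → Prop}
    {x y : HardVertex b L β m} (hx : level x < L) (hy : level y < L) :
    (network m A B).Adj x y ↔ (network m A B').Adj x y := by
  have key : ∀ B B' (x y : HardVertex b L β m), level x < L → ShortcutRel A B x y →
      ShortcutRel A B' x y := by
    rintro B B' (i | j | ⟨c, x, s⟩ | s | w) (i' | j' | ⟨c', x', s'⟩ | s' | w') hx h <;>
      simp only [ShortcutRel, level, coord] at h hx ⊢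
    · exact h
    · omega
  simp only [network, SimpleGraph.sup_adj, SimpleGraph.fromRel_adj]
  exact or_congr Iff.rfl (and_congr Iff.rfl (or_congr ⟨key B B' x y hx, key B' B x y hx⟩
    ⟨key B B' y x hy, key B' B y x hy⟩))

/-- Above the level of the left star, the network does not depend on `A`. -/
theorem network_adj_congr_left {A A' B : (Fin b → Bool) → Prop}
    {x y : HardVertex b L β m} (hx : β < level x) (hy : β < level y) :
    (network m A B).Adj x y ↔ (network m A' B).Adj x y := by
  have key : ∀ A A' (x y : HardVertex b L β m), β < level x → ShortcutRel A B x y →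
      ShortcutRel A' B x y := by
    rintro A A' (i | j | ⟨c, x, s⟩ | s | w) (i' | j' | ⟨c', x', s'⟩ | s' | w') hx h <;>
      simp only [ShortcutRel, level, coord] at h hx ⊢
    · omega
    · exact h
  simp only [network, SimpleGraph.sup_adj, SimpleGraph.fromRel_adj]
  exact or_congr Iff.rfl (and_congr Iff.rfl (or_congr ⟨key A A' x y hx, key A' A x y hx⟩
    ⟨key A A' y x hy, key A' A y x hy⟩))

end HardVertex

/-! ### Networks from graphs on other vertex types -/

theorem SimpleGraph.Iso.dist_eq {V W : Type*} {G : SimpleGraph V} {G' : SimpleGraph W}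
    (φ : G ≃g G') (hG : G.Connected) (x y : V) : G'.dist (φ x) (φ y) = G.dist x y := by
  refine le_antisymm ?_ ?_
  · obtain ⟨p, hp⟩ := hG.exists_walk_length_eq_dist x y
    rw [← hp, ← SimpleGraph.Walk.length_map φ.toHom p]
    exact SimpleGraph.dist_le _
  · obtain ⟨p, hp⟩ := (φ.connected_iff.1 hG).exists_walk_length_eq_dist (φ x) (φ y)
    rw [← hp, ← SimpleGraph.Walk.length_map φ.symm.toHom p]
    have := SimpleGraph.dist_le (p.map φ.symm.toHom)
    simpa using this

section

variable {V : Type*} {c n : ℕ}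

open Classical in
/-- The network with graph `G` and marked edges `H`, transported along a numbering of the
vertices; the identities are the numbers `1, …, n`. -/
noncomputable def networkOf (hc : 1 ≤ c) (e : V ≃ Fin n) (G H : SimpleGraph V)
    (hG : G.Connected) : LabeledNetwork (Finset ℕ) c n where
  graph := G.comap e.symm
  connected := (SimpleGraph.Iso.comap e.symm G).connected_iff.2 hG
  label v :=
    (Finset.univ.filter fun w => H.Adj (e.symm v) (e.symm w)).image fun w => w.val + 1
  id v := v.val + 1
  id_injective v w h := Fin.ext (Nat.succ_injective h)
  one_le_id v := Nat.succ_pos _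
  id_le v := v.2.trans_le (Nat.le_self_pow (by omega) n)

variable {hc : 1 ≤ c} {e : V ≃ Fin n} {G H : SimpleGraph V} {hG : G.Connected}

theorem mem_label_networkOf {v w : Fin n} :
    (networkOf hc e G H hG).id w ∈ (networkOf hc e G H hG).label v ↔
      H.Adj (e.symm v) (e.symm w) := by
  simp [networkOf, ← Fin.ext_iff]

theorem markedGraph_networkOf : markedGraph (networkOf hc e G H hG) = H.comap e.symm := by
  ext v w
  simp only [markedGraph, SimpleGraph.fromRel_adj, mem_label_networkOf, SimpleGraph.comap_adj,
    H.adj_comm (e.symm w), or_self, and_iff_right_iff_imp]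
  rintro h rfl
  exact h.ne rfl

theorem isAdditiveSpanner_networkOf (hHG : H ≤ G) (hH : H.Connected) {β : ℕ} :
    IsAdditiveSpanner β (networkOf hc e G H hG) ↔ ∀ x y, H.dist x y ≤ G.dist x y + β := by
  have hlab : ∀ v, ∀ i ∈ (networkOf hc e G H hG).label v,
      ∃ w, (networkOf hc e G H hG).graph.Adj v w ∧ (networkOf hc e G H hG).id w = i := by
    intro v i hi
    obtain ⟨w, hw, rfl⟩ := Finset.mem_image.1 hi
    simp only [Finset.mem_filter, Finset.mem_univ, true_and] at hw
    exact ⟨w, hHG hw, rfl⟩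
  have hdist : ∀ x y, (markedGraph (networkOf hc e G H hG)).edist x y ≤
      (networkOf hc e G H hG).graph.edist x y + (β : ℕ∞) ↔
      H.dist (e.symm x) (e.symm y) ≤ G.dist (e.symm x) (e.symm y) + β := by
    intro x y
    rw [markedGraph_networkOf]
    have hH' : (H.comap e.symm).Connected := (SimpleGraph.Iso.comap e.symm H).connected_iff.2 hH
    have h1 := (SimpleGraph.Iso.comap e.symm H).dist_eq hH' x y
    have h2 := (SimpleGraph.Iso.comap e.symm G).dist_eq (networkOf hc e G H hG).connected x y
    rw [SimpleGraph.Iso.comap_apply] at h1 h2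
    rw [← (hH'.preconnected x y).coe_dist_eq_edist,
      ← ((networkOf hc e G H hG).connected.preconnected x y).coe_dist_eq_edist]
    rw [SimpleGraph.Iso.comap_apply] at h1 h2
    rw [h1, h2]
    exact_mod_cast Iff.rfl
  simp only [IsAdditiveSpanner, hdist]
  constructor
  · rintro ⟨-, h⟩ x y
    simpa using h (e x) (e y)
  · exact fun h => ⟨hlab, fun x y => h _ _⟩

end

/-! ### Indistinguishable networks -/

section

variable {L : Type} {c n t : ℕ} {I J : LabeledNetwork L c n} {R : Set (Fin n)} {v : Fin n}

theorem ball_subset_of_agree (hI : I.ball t v ⊆ R)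
    (hadj : ∀ x ∈ R, ∀ y ∈ R, (I.graph.Adj x y ↔ J.graph.Adj x y)) : I.ball t v ⊆ J.ball t v := by
  have key : ∀ k ≤ t, ∀ w, I.graph.dist v w = k → J.graph.dist v w ≤ k := by
    intro k
    induction k with
    | zero =>
      intro _ w hw
      rw [I.connected.dist_eq_zero_iff] at hw
      simp [hw]
    | succ k ih =>
      intro hk w hw
      obtain ⟨p, hp⟩ := I.connected.exists_walk_length_eq_dist w v
      rw [SimpleGraph.dist_comm, hw] at hp
      obtain ⟨x, hx, q, hq⟩ := SimpleGraph.exists_walk_length_succ_iff.1 ⟨p, hp⟩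
      have h1 := SimpleGraph.dist_le q
      have h2 := I.connected.dist_triangle (u := v) (v := x) (w := w)
      rw [SimpleGraph.dist_comm, hq] at h1
      rw [SimpleGraph.dist_eq_one_iff_adj.2 hx.symm] at h2
      have h3 := ih (by omega) x (by omega)
      have hwR : w ∈ R := hI (show I.graph.dist v w ≤ t by omega)
      have hxR : x ∈ R := hI (show I.graph.dist v x ≤ t by omega)
      have h4 := J.connected.dist_triangle (u := v) (v := x) (w := w)
      rw [SimpleGraph.dist_eq_one_iff_adj.2 ((hadj x hxR w hwR).1 hx.symm)] at h4
      omega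
  exact fun w hw => (key _ hw w rfl).trans hw

/-- Two networks that agree on a set of nodes look the same to all nodes whose balls are contained
in this set. -/
theorem view_eq_of_agree {cert cert' : Fin n → List Bool} (hid : I.id = J.id)
    (hlabel : I.label = J.label) (hI : I.ball t v ⊆ R) (hJ : J.ball t v ⊆ R)
    (hadj : ∀ x ∈ R, ∀ y ∈ R, (I.graph.Adj x y ↔ J.graph.Adj x y))
    (hcert : ∀ x ∈ R, cert x = cert' x) : I.view t cert v = J.view t cert' v := by
  have hball : I.ball t v = J.ball t v := (ball_subset_of_agree hI hadj).antisymm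
    (ball_subset_of_agree hJ fun x hx y hy => (hadj x hx y hy).symm)
  simp only [LabeledNetwork.view, LocalView.mk.injEq, hid, hlabel, true_and, ← hball]
  constructor
  · ext a
    refine exists_congr fun w => and_congr_right fun hw => ?_
    rw [hcert w (hI hw)]
  · ext a
    refine exists_congr fun u => and_congr_right fun hu => exists_congr fun w =>
      and_congr_right fun hw => and_congr_left fun _ => hadj u (hI hu) w (hI hw)

end

/-! ### The cut argument -/

/-- The bit strings of length at most `s`, as a finite type. -/
abbrev ShortString (s : ℕ) : Type := Σ k : Fin (s + 1), Fin k → Bool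

theorem card_shortString (s : ℕ) : Fintype.card (ShortString s) = 2 ^ (s + 1) - 1 := by
  simp only [ShortString, Fintype.card_sigma, Fintype.card_fun, Fintype.card_bool,
    Fintype.card_fin]
  rw [Fin.sum_univ_eq_sum_range (fun k => 2 ^ k), Nat.geomSum_eq le_rfl]
  simp

theorem exists_shortString {s : ℕ} {l : List Bool} (h : l.length ≤ s) :
    ∃ σ : ShortString s, List.ofFn σ.2 = l :=
  ⟨⟨⟨l.length, by omega⟩, l.get⟩, List.ofFn_get l⟩

namespace HardVertex

variable {b β m t : ℕ}

/-- The vertices strictly between the two stars. -/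
def middle : Option (Fin b × Bool) × Fin (2 * t) → HardVertex b (β + 2 * t + 1) β m
  | (some (c, x), k) => bit c x ⟨β + 1 + k, by omega⟩
  | (none, k) => hub ⟨β + 1 + k, by omega⟩

theorem exists_middle {x : HardVertex b (β + 2 * t + 1) β m} (h1 : β < level x)
    (h2 : level x < β + 2 * t + 1) : ∃ q, middle q = x := by
  rcases x with i | j | ⟨c, x, s⟩ | s | w <;> simp only [level, coord] at h1 h2
  · omega
  · omega
  · exact ⟨(some (c, x), ⟨s.val - (β + 1), by omega⟩), by
      simp only [middle, bit.injEq, true_and]; exact Fin.ext (by simp only; omega)⟩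
  · exact ⟨(none, ⟨s.val - (β + 1), by omega⟩), by
      simp only [middle, hub.injEq]; exact Fin.ext (by simp only; omega)⟩
  · omega

end HardVertex

/-- If the middle part of the hard instances has fewer certificates of size at most `s` than there
are sets of bit vectors, then two of the instances for complementary sets can be joined to an
instance without a spanner that is accepted. -/
theorem succ_le_sizePLS {c n b β m s t : ℕ} (hc : 1 ≤ c) (hβ : 1 ≤ β)
    (hn : 2 * 2 ^ b + 2 * b * (β + 2 * t + 1 + 1) + (β + 2 * t + 1 + β + 1) + m = n)
    (hcount : (2 ^ (s + 1) - 1) ^ ((2 * b + 1) * (2 * t)) < 2 ^ 2 ^ b) :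
    ((s + 1 : ℕ) : ℕ∞) ≤ sizePLS t (IsAdditiveSpanner β (c := c) (n := n)) := by
  refine le_iInf fun p => le_iInf fun V => le_iInf fun hpls => ?_
  by_contra! hlt
  set L := β + 2 * t + 1 with hLdef
  have hL : β ≤ L := by omega
  have e : HardVertex b L β m ≃ Fin n :=
    Fintype.equivFinOfCardEq (HardVertex.card.trans hn)
  let N : ((Fin b → Bool) → Prop) → ((Fin b → Bool) → Prop) → LabeledNetwork (Finset ℕ) c n :=
    fun A B => networkOf hc e (HardVertex.network m A B) (HardVertex.spannerGraph b L β m)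
      (HardVertex.network_connected A B)
  have hyes : ∀ a : (Fin b → Bool) → Bool,
      IsAdditiveSpanner β (N (fun i => a i = true) (fun i => a i = false)) := fun a =>
    (isAdditiveSpanner_networkOf (HardVertex.spannerGraph_le_network _ _)
      HardVertex.spannerGraph_connected).2
      (HardVertex.dist_le_of_disjoint hL fun i hi hi' => by simp [hi] at hi')
  have hno : ∀ (A B : (Fin b → Bool) → Prop) i, A i → B i → ¬ IsAdditiveSpanner β (N A B) := by
    intro A B i hA hB h
    have h1 := (isAdditiveSpanner_networkOf (HardVertex.spannerGraph_le_network _ _)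
      HardVertex.spannerGraph_connected).1 h (.left i) (.right i)
    have h2 := HardVertex.lt_dist_of_common (m := m) hβ hL hA hB
    omega
  let C : ((Fin b → Bool) → Bool) → Fin n → List Bool := fun a =>
    p (N (fun i => a i = true) (fun i => a i = false))
  have hlen : ∀ a v, (C a v).length ≤ s := by
    intro a v
    have h1 : ((C a v).length : ℕ∞) ≤ certSize (IsAdditiveSpanner β) p :=
      le_iSup_of_le _ (le_iSup_of_le (hyes a) (le_iSup_of_le v le_rfl))
    have h2 : ((C a v).length : ℕ∞) < (s + 1 : ℕ) := h1.trans_lt hlt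
    have h3 : (C a v).length < s + 1 := by exact_mod_cast h2
    omega
  choose σ hσ using fun a v => exists_shortString (hlen a v)
  -- two instances with the same certificates in the middle
  obtain ⟨a, a', hne, heq⟩ := Fintype.exists_ne_map_eq_of_card_lt
    (fun (a : (Fin b → Bool) → Bool) (q : Option (Fin b × Bool) × Fin (2 * t)) =>
      σ a (e (HardVertex.middle q))) (by
        simp only [Fintype.card_fun, card_shortString, Fintype.card_prod, Fintype.card_option,
          Fintype.card_fin, Fintype.card_bool]
        rwa [mul_comm b 2])
  have hmid : ∀ x, β < HardVertex.level x → HardVertex.level x < L → C a (e x) = C a' (e x) := by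
    intro x h1 h2
    obtain ⟨q, rfl⟩ := HardVertex.exists_middle h1 h2
    have h3 : σ a (e (HardVertex.middle q)) = σ a' (e (HardVertex.middle q)) := congrFun heq q
    rw [← hσ a, ← hσ a', h3]
  clear heq
  wlog hi : ∃ i, a i = true ∧ a' i = false generalizing a a'
  · refine this a' a hne.symm (fun x h1 h2 => (hmid x h1 h2).symm) ?_
    obtain ⟨i, hi'⟩ := Function.ne_iff.1 hne
    refine ⟨i, ?_⟩
    by_contra h
    refine hi ⟨i, ?_⟩
    revert hi' h
    cases a i <;> cases a' i <;> simp
  obtain ⟨i, hi1, hi2⟩ := hi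
  -- the left half of the first and the right half of the second instance
  let lev : Fin n → ℕ := fun v => HardVertex.level (e.symm v)
  let J := N (fun i => a i = true) (fun i => a' i = false)
  let cert : Fin n → List Bool := fun v => if lev v ≤ β + t then C a v else C a' v
  refine hpls.sound J (hno _ _ i hi1 hi2) cert fun v => ?_
  have hlip : ∀ A B (v w : Fin n), lev w ≤ lev v + (N A B).graph.dist v w := fun A B v w =>
    (N A B).connected.le_add_dist (fun x y h => HardVertex.level_le_of_adj hL h) v w
  have hmid' : ∀ v, β < lev v → lev v < L → C a v = C a' v := fun v h1 h2 => by
    simpa using hmid (e.symm v) h1 h2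
  by_cases hv : lev v ≤ β + t
  · have hball : ∀ A B, (N A B).ball t v ⊆ {w | lev w < L} := fun A B w hw => by
      have := hlip A B v w
      have hw' : (N A B).graph.dist v w ≤ t := hw
      exact show lev w < L by omega
    have hview : J.view t cert v =
        (N (fun i => a i = true) (fun i => a i = false)).view t (C a) v := by
      refine view_eq_of_agree rfl rfl (hball _ _) (hball _ _) (fun x hx y hy => ?_)
        (fun x hx => ?_)
      · exact HardVertex.network_adj_congr_right hL hx hy
      · by_cases hx' : lev x ≤ β + t
        · simp only [cert, if_pos hx']
        · simp only [cert, if_neg hx']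
          exact (hmid' x (by omega) hx).symm
    rw [hview]
    exact hpls.complete _ (hyes a) v
  · have hball : ∀ A B, (N A B).ball t v ⊆ {w | β < lev w} := fun A B w hw => by
      have := hlip A B w v
      have hw' : (N A B).graph.dist v w ≤ t := hw
      rw [SimpleGraph.dist_comm] at hw'
      exact show β < lev w by omega
    have hview : J.view t cert v =
        (N (fun i => a' i = true) (fun i => a' i = false)).view t (C a') v := by
      refine view_eq_of_agree rfl rfl (hball _ _) (hball _ _) (fun x hx y hy => ?_)
        (fun x hx => ?_)
      · exact HardVertex.network_adj_congr_left hx hy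
      · by_cases hx' : lev x ≤ β + t
        · simp only [cert, if_pos hx']
          exact hmid' x hx (by omega)
        · simp only [cert, if_neg hx']
    rw [hview]
    exact hpls.complete _ (hyes a') v

/-! ### The lower bound -/

/-- If `q` bits for each of the `(2 * b + 1) * (2 * t)` vertices between the two sides make at most
`2 ^ b` bits, then some certificate has at least `q` bits. -/
theorem le_sizePLS_of_mul_le {c n b β q t : ℕ} (hc : 1 ≤ c) (hβ : 1 ≤ β) (ht : 1 ≤ t)
    (hn : 2 * 2 ^ b + 2 * b * (β + 2 * t + 1 + 1) + (β + 2 * t + 1 + β + 1) ≤ n)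
    (hq : q * ((2 * b + 1) * (2 * t)) ≤ 2 ^ b) :
    (q : ℕ∞) ≤ sizePLS t (IsAdditiveSpanner β (c := c) (n := n)) := by
  obtain _ | s := q
  · simp
  · obtain ⟨m, hm⟩ := Nat.exists_eq_add_of_le hn
    refine succ_le_sizePLS hc hβ hm.symm ?_
    calc (2 ^ (s + 1) - 1) ^ ((2 * b + 1) * (2 * t))
        < (2 ^ (s + 1)) ^ ((2 * b + 1) * (2 * t)) :=
          Nat.pow_lt_pow_left (Nat.sub_lt (by positivity) one_pos) (by positivity)
      _ = 2 ^ ((s + 1) * ((2 * b + 1) * (2 * t))) := (pow_mul _ _ _).symm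
      _ ≤ 2 ^ 2 ^ b := Nat.pow_le_pow_right (by norm_num) hq

theorem four_le_log {n : ℕ} (hn : 6400 ≤ n) : 4 ≤ Real.log n := by
  rw [Real.le_log_iff_exp_le (by exact_mod_cast (by omega : 0 < n))]
  have h1 : Real.exp 4 = Real.exp 1 ^ 4 := by rw [← Real.exp_nat_mul]; norm_num
  have h2 : Real.exp 1 ^ 4 ≤ 3 ^ 4 := by
    gcongr
    exact Real.exp_one_lt_d9.le.trans (by norm_num)
  have h3 : (6400 : ℝ) ≤ n := by exact_mod_cast hn
  rw [h1]
  linarith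

theorem mul_log_le {n k : ℕ} (hk : 1 ≤ k) (hn : 6400 * k ^ 2 ≤ n) : 40 * k * Real.log n ≤ n := by
  have hn0 : (0 : ℝ) < n := by
    have : 0 < 6400 * k ^ 2 := by positivity
    exact_mod_cast this.trans_le hn
  have h1 : Real.log n ≤ 2 * √n := by
    have h := Real.log_le_sub_one_of_pos (Real.sqrt_pos.2 hn0)
    rw [Real.log_sqrt hn0.le] at h
    linarith
  have h2 : (80 * k : ℝ) ≤ √n := by
    refine Real.le_sqrt_of_sq_le ?_
    have : (6400 * k ^ 2 : ℝ) ≤ n := by exact_mod_cast hn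
    nlinarith
  have h3 : √n * √n = n := Real.mul_self_sqrt hn0.le
  have h4 : (0 : ℝ) ≤ 40 * k := by positivity
  nlinarith [mul_le_mul_of_nonneg_left h1 h4, mul_le_mul_of_nonneg_right h2 (Real.sqrt_nonneg n)]

/-- The minimum size is at least `n / t` up to the square of a logarithm. -/
theorem lower_bound {c β n t : ℕ} (hc : 1 ≤ c) (hβ : 1 ≤ β) (hn : 6400 * (β + 1) ^ 2 ≤ n)
    (ht : 1 ≤ t) (htn : (t : ℝ) ≤ n / Real.log n) :
    ENNReal.ofReal ((n / t) / (320 * Real.log n ^ 2)) ≤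
      (sizePLS t (IsAdditiveSpanner β (c := c) (n := n)) : ℝ≥0∞) := by
  have hn1 : 6400 ≤ n := (Nat.le_mul_of_pos_right 6400 (by positivity)).trans hn
  have hlog := four_le_log hn1
  have hβn := mul_log_le (k := β + 1) (by omega) hn
  set l := Real.log n with hl
  have hl0 : 0 < l := by linarith
  have ht0 : (1 : ℝ) ≤ t := by exact_mod_cast ht
  have hβ0 : (1 : ℝ) ≤ β := by exact_mod_cast hβ
  push_cast at hβn
  have htn' : t * l ≤ n := (le_div_iff₀ hl0).1 htn
  suffices h : ∃ q : ℕ, (n / t : ℝ) / (320 * l ^ 2) ≤ q ∧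
      (q : ℕ∞) ≤ sizePLS t (IsAdditiveSpanner β (c := c) (n := n)) by
    obtain ⟨q, h1, h2⟩ := h
    calc ENNReal.ofReal ((n / t : ℝ) / (320 * l ^ 2)) ≤ ENNReal.ofReal q :=
          ENNReal.ofReal_le_ofReal h1
      _ = ((q : ℕ∞) : ℝ≥0∞) := by rw [ENNReal.ofReal_natCast, ENat.toENNReal_coe]
      _ ≤ _ := ENat.toENNReal_le.2 h2
  by_cases hcase : (n / t : ℝ) ≤ 320 * l ^ 2
  · -- one bit is needed, by the instances without bit paths
    refine ⟨1, ?_, ?_⟩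
    · rw [Nat.cast_one]
      exact div_le_one_of_le₀ hcase (by positivity)
    · refine succ_le_sizePLS (b := 0) (m := n - (2 * t + 2 * β + 4)) (s := 0) hc hβ ?_ (by simp)
      have h1 : ((2 * t + 2 * β + 4 : ℕ) : ℝ) ≤ n := by
        push_cast
        nlinarith
      have h2 : 2 * t + 2 * β + 4 ≤ n := by exact_mod_cast h1
      simp only [pow_zero]
      omega
  · -- between an eighth and a quarter of the vertices are of the form `left i` or `right j`
    rw [not_le, lt_div_iff₀ (by linarith)] at hcase
    have hlt : l * (l * t) * 320 ≤ n := by nlinarith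
    have hlt' : l * t * 1280 ≤ n := by
      have : 4 * (l * t) ≤ l * (l * t) := by gcongr
      linarith
    set b := Nat.log 2 (n / 8) with hb
    have hb1 : 2 ^ b ≤ n / 8 := Nat.pow_log_le_self 2 (by omega)
    have hb2 : n / 8 < 2 ^ (b + 1) := Nat.lt_pow_succ_log_self (by norm_num) _
    have hb3 : (2 ^ b : ℝ) * 8 ≤ n := by
      have : 2 ^ b * 8 ≤ n := by omega
      exact_mod_cast this
    have hb4 : (n : ℝ) ≤ 2 ^ b * 16 := by
      rw [pow_succ] at hb2
      have : n ≤ 2 ^ b * 16 := by omega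
      exact_mod_cast this
    have hb5 : (b : ℝ) ≤ 2 * l := by
      have h1 : (b : ℝ) * Real.log 2 ≤ l := by
        rw [← Real.log_pow]
        exact Real.log_le_log (by positivity) (by nlinarith [show (0 : ℝ) < 2 ^ b by positivity])
      have h2 := Real.log_two_gt_d9
      have h3 : (b : ℝ) * (1 / 2) ≤ b * Real.log 2 := by gcongr; linarith
      linarith
    have hmid : (2 * b + 1) * (2 * t : ℝ) ≤ 10 * (l * t) := by
      calc (2 * b + 1) * (2 * t : ℝ) ≤ (5 * l) * (2 * t) := by gcongr; linarith
        _ = 10 * (l * t) := by ring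
    set q := 2 ^ b / ((2 * b + 1) * (2 * t)) with hq
    have hpos : 0 < (2 * b + 1) * (2 * t) := by positivity
    have hmidq : ((2 * b + 1 : ℝ) * (2 * t)) * (q + 1) ≥ 2 ^ b := by
      have := (Nat.lt_mul_div_succ (2 ^ b) hpos).le
      rw [← hq] at this
      exact_mod_cast this
    refine ⟨q, ?_, le_sizePLS_of_mul_le (b := b) hc hβ ht ?_ (Nat.div_mul_le_self _ _)⟩
    · have hq1 : (1 : ℝ) ≤ q := by
        have : 1 ≤ q := by
          rw [hq, Nat.one_le_div_iff hpos]
          have h1 : (2 * b + 1) * (2 * t : ℝ) ≤ 2 ^ b := by nlinarith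
          exact_mod_cast h1
        exact_mod_cast this
      rw [div_div, div_le_iff₀ (by positivity)]
      have h1 : (n : ℝ) ≤ 10 * (l * t) * (2 * q) * 16 := by
        calc (n : ℝ) ≤ 2 ^ b * 16 := hb4
          _ ≤ ((2 * b + 1 : ℝ) * (2 * t)) * (q + 1) * 16 := by gcongr
          _ ≤ 10 * (l * t) * (2 * q) * 16 := by gcongr; linarith
      have h2 : (l * t) * q ≤ l * (l * t) * q := by
        gcongr
        have : 0 ≤ l * (t : ℝ) := by positivity
        nlinarith
      nlinarith
    · have h1 : ((2 * 2 ^ b + 2 * b * (β + 2 * t + 1 + 1) + (β + 2 * t + 1 + β + 1) : ℕ) : ℝ)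
          ≤ n := by
        push_cast
        have h2 : 2 * (b : ℝ) * (β + 2 * t + 1 + 1) ≤ 2 * (2 * l) * (β + 2 * t + 1 + 1) := by
          gcongr
        have h3 : (t : ℝ) ≤ l * t := by nlinarith
        have h4 : (β : ℝ) ≤ β * l := by nlinarith
        nlinarith
      exact_mod_cast h1

/-! ### Spanners without additive error -/

/-- A `0`-additive spanner contains all edges, which needs no certificates. -/
theorem exists_trivial_scheme (c : ℕ) {t : ℕ} (ht : 1 ≤ t) :
    ∃ (p : ∀ n, Prover (Finset ℕ) c n) (V : Verifier (Finset ℕ)),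
      (∀ n, IsPLS t (IsAdditiveSpanner 0) (p n) V) ∧
      ∀ n, certSize (IsAdditiveSpanner 0) (p n) = 0 := by
  let V : Verifier (Finset ℕ) := fun W =>
    (∀ i ∈ W.labelOf W.center, W.netGraph.Adj W.center i) ∧
      ∀ b, W.netGraph.Adj W.center b → W.spannerGraph.Adj W.center b
  have hV : ∀ {n} (I : LabeledNetwork (Finset ℕ) c n) cert v, V (I.view t cert v) ↔
      (∀ i ∈ I.label v, ∃ w, I.graph.Adj v w ∧ I.id w = i) ∧
        ∀ w, I.graph.Adj v w → I.spanner.Adj v w := by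
    intro n I cert v
    have hcen : (I.view t cert v).center = I.id v := rfl
    simp only [V, hcen, I.labelOf_view (I.self_mem_ball t v), I.netGraph_view_adj_center ht,
      I.spannerGraph_view_adj_center ht]
    refine and_congr (forall₂_congr fun i _ => exists_congr fun w => and_congr_right fun _ => eq_comm)
      ⟨fun h w hw => ?_, ?_⟩
    · obtain ⟨w', hw', he⟩ := h (I.id w) ⟨w, hw, rfl⟩
      rwa [I.id_injective he]
    · rintro h b ⟨w, hw, rfl⟩
      exact ⟨w, h w hw, rfl⟩
  obtain ⟨p, h1, h2⟩ := exists_prover (P := fun n => IsAdditiveSpanner 0 (c := c) (n := n))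
    (V := V) (t := t) (B := fun _ => 0)
    (fun n I hI => ⟨fun _ => [], fun v => (hV I _ v).2 ⟨hI.1 v, fun w hw => ⟨by
      have h := hI.2 v w
      rw [SimpleGraph.edist_eq_one_iff_adj.2 hw, Nat.cast_zero, add_zero,
        SimpleGraph.edist_le_one_iff_adj_or_eq] at h
      exact h.resolve_right hw.ne, hw⟩⟩, by simp⟩)
    (fun n I cert h => ⟨fun v => ((hV I cert v).1 (h v)).1, fun u v => by
      rw [Nat.cast_zero, add_zero]
      exact SimpleGraph.edist_anti fun v w hvw => (((hV I cert v).1 (h v)).2 w hvw).1⟩)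
  exact ⟨p, V, h1, fun n => by simpa using h2 n⟩

theorem isSpanner_one_eq (β : ℕ) {c n : ℕ} :
    (IsSpanner 1 β : LabeledNetwork (Finset ℕ) c n → Prop) = IsAdditiveSpanner β := by
  funext I
  simp [IsSpanner, IsAdditiveSpanner]

theorem theorem4 (c : ℕ) (hc : 1 ≤ c) :
    -- one round, certificates of size `O(n)`
    (∃ C : ℝ, 0 < C ∧ ∀ α β : ℕ, 1 ≤ α →
      ∃ (p : ∀ n, Prover (Finset ℕ) c n) (V : Verifier (Finset ℕ)),
        (∀ n, IsPLS 1 (IsSpanner α β) (p n) V) ∧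
        ∀ n : ℕ, 1 ≤ n →
          (certSize (IsSpanner α β) (p n) : ℝ≥0∞) ≤ ENNReal.ofReal (C * n)) ∧
    -- `t` rounds, certificates of size `O((n / t) * polylog n)`
    (∃ (C : ℝ) (k : ℕ), 0 < C ∧ ∀ α β : ℕ, 1 ≤ α → ∀ t : ℕ, 1 ≤ t →
      ∃ (p : ∀ n, Prover (Finset ℕ) c n) (V : Verifier (Finset ℕ)),
        (∀ n, IsPLS t (IsSpanner α β) (p n) V) ∧
        ∀ n : ℕ, 2 ≤ n →
          (certSize (IsSpanner α β) (p n) : ℝ≥0∞) ≤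
            ENNReal.ofReal (C * Real.log n ^ k * (n / t))) ∧
    -- weak linear scaling for additive spanners on `[1, n / log n]`
    (∀ β : ℕ, ∃ (C : ℝ) (k n₀ : ℕ), 0 < C ∧ ∀ t : ℕ, 1 ≤ t →
      ∃ (p : ∀ n, Prover (Finset ℕ) c n) (V : Verifier (Finset ℕ)),
        (∀ n, IsPLS t (IsAdditiveSpanner β) (p n) V) ∧
        ∀ n : ℕ, n₀ ≤ n → (t : ℝ) ≤ n / Real.log n →
          (certSize (IsAdditiveSpanner β) (p n) : ℝ≥0∞) ≤
            ENNReal.ofReal (C * Real.log n ^ k * (1 / t)) *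
              (sizePLS 1 (IsAdditiveSpanner β (c := c) (n := n)) : ℝ≥0∞)) ∧
    -- the minimum size for additive spanners is `n / t` up to polylogarithmic factors
    (∀ β : ℕ, 1 ≤ β → ∃ (C : ℝ) (k n₀ : ℕ), 0 < C ∧ ∀ n t : ℕ, n₀ ≤ n → 1 ≤ t →
      (t : ℝ) ≤ n / Real.log n →
        ENNReal.ofReal ((n / t) / (C * Real.log n ^ k)) ≤
            (sizePLS t (IsAdditiveSpanner β (c := c) (n := n)) : ℝ≥0∞) ∧
        (sizePLS t (IsAdditiveSpanner β (c := c) (n := n)) : ℝ≥0∞) ≤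
            ENNReal.ofReal (C * Real.log n ^ k * (n / t))) := by
  refine ⟨⟨40 + 4 * c, by positivity, fun α β hα => ?_⟩,
    ⟨48 * (8 * c + 11), 1, by positivity, fun α β hα t ht => exists_spread_scheme hc hα β ht⟩,
    fun β => ?_, fun β hβ => ?_⟩
  · obtain ⟨p, V, h1, h2⟩ := exists_linear_scheme c hα β
    refine ⟨p, V, h1, fun n _ => (ENat.toENNReal_le.2 (h2 n)).trans ?_⟩
    rw [ENat.toENNReal_coe, ← ENNReal.ofReal_natCast]
    push_cast
    exact le_rfl
  · rcases Nat.eq_zero_or_pos β with rfl | hβ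
    · refine ⟨1, 0, 0, one_pos, fun t ht => ?_⟩
      obtain ⟨p, V, h1, h2⟩ := exists_trivial_scheme c ht
      exact ⟨p, V, h1, fun n _ _ => by simp [h2]⟩
    · refine ⟨48 * (8 * c + 11) * 320, 3, 6400 * (β + 1) ^ 2, by positivity, fun t ht => ?_⟩
      obtain ⟨p, V, h1, h2⟩ := exists_spread_scheme hc le_rfl β ht
      simp only [isSpanner_one_eq] at h1 h2
      refine ⟨p, V, h1, fun n hn _ => ?_⟩
      have hn1 : 6400 ≤ n := (Nat.le_mul_of_pos_right 6400 (by positivity)).trans hn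
      have hlog := four_le_log hn1
      have hlogn : Real.log n ≤ n := (Real.log_le_sub_one_of_pos
        (by exact_mod_cast (by omega : 0 < n))).trans (by linarith)
      have hlow := lower_bound (t := 1) hc hβ hn le_rfl
        (by rw [Nat.cast_one, one_le_div (by linarith)]; exact hlogn)
      refine (h2 n (by omega)).trans (le_trans ?_ (mul_le_mul_right hlow _))
      rw [← ENNReal.ofReal_mul (by positivity)]
      refine ENNReal.ofReal_le_ofReal (le_of_eq ?_)
      have ht0 : (t : ℝ) ≠ 0 := by positivity
      have hl0 : Real.log n ≠ 0 := by positivity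
      rw [Nat.cast_one, div_one]
      field_simp
  · refine ⟨48 * (8 * c + 11), 2, 6400 * (β + 1) ^ 2, by positivity, fun n t hn ht htn => ⟨?_, ?_⟩⟩
    · refine le_trans (ENNReal.ofReal_le_ofReal ?_) (lower_bound hc hβ hn ht htn)
      have hn1 : 6400 ≤ n := (Nat.le_mul_of_pos_right 6400 (by positivity)).trans hn
      have hlog := four_le_log hn1
      gcongr
      have : (0 : ℝ) ≤ c := by positivity
      linarith
    · obtain ⟨p, V, h1, h2⟩ := exists_spread_scheme hc le_rfl β ht
      simp only [isSpanner_one_eq] at h1 h2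
      have hn1 : 6400 ≤ n := (Nat.le_mul_of_pos_right 6400 (by positivity)).trans hn
      have hlog := four_le_log hn1
      refine le_trans (ENat.toENNReal_le.2 (iInf_le_of_le (p n) (iInf_le_of_le V
        (iInf_le_of_le (h1 n) le_rfl)))) ((h2 n (by omega)).trans (ENNReal.ofReal_le_ofReal ?_))
      gcongr
      · linarith
      · norm_num
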